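/- Let $\beta>0$. For $\delta\ge 0$ put $Q_\delta(t)=t^2+2\delta\log\frac1{|t|}$ and, for a probability measure $\nu$ on $\mathbb R$, $$E_{\beta,\delta}(\nu)=\frac{\beta}{2}\int_{\mathbb R^2}\log\frac{1}{|s-t|}\,\nu(ds)\,\nu(dt)+\int_{\mathbb R}Q_\delta(t)\,\nu(dt)\in(-\infty,+\infty],$$ where $E_{\beta,\delta}(\nu)=+\infty$ if $\int Q_\delta\,d\nu=+\infty$. Let $E^*_{\beta,\delta}=\inf_\nu E_{\beta,\delta}(\nu)$ be the infimum over all probability measures on $\mathbb R$; a probability measure $\nu$ is called an equilibrium measure for $E_{\beta,\delta}$ if $E_{\beta,\delta}(\nu)=E^*_{\beta,\delta}$ and this value is finite. Let $\nu_{\beta,\delta}$ be the measure on $\mathbb R$ with Lebesgue density $$f_{\beta,\delta}(t)=\frac{2}{\pi\beta}\,\frac1{|t|}\sqrt{(t^2-a^2)(b^2-t^2)}\ \text{ for } t\in[-b,-a]\cup[a,b],\qquad f_{\beta,\delta}(t)=0\ \text{ otherwise,}$$ where $$a=\sqrt{\tfrac{\beta}{2}}\sqrt{1+\tfrac{2\delta}{\beta}-\sqrt{1+\tfrac{4\delta}{\beta}}},\qquad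 b=\sqrt{\tfrac{\beta}{2}}\sqrt{1+\tfrac{2\delta}{\beta}+\sqrt{1+\tfrac{4\delta}{\beta}}}.$$ **Lemma 4.5.** Let $(\mu_n)_{n}$ be a sequence of nonnegative real numbers such that $\alpha_n:=\mu_n/n\to c\in\mathbb R$ as $n\to\infty$. Then $\nu_{\beta,c}$ and all $\nu_{\beta,\alpha_n}$, $n\ge1$, are equilibrium measures for $E_{\beta,c}$ and $E_{\beta,\alpha_n}$ respectively, and 1. $\nu_{\beta,\alpha_n}$ converges weakly to $\nu_{\beta,c}$, that is, $\int f\,d\nu_{\beta,\alpha_n}\to\int f\,d\nu_{\beta,c}$ for every bounded continuous $f:\mathbb R\to\mathbb R$; 2. $E^*_{\beta,\alpha_n}\to E^*_{\beta,c}$. -/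

import Mathlib

open MeasureTheory Filter Topology
open scoped ENNReal BoundedContinuousFunction

noncomputable section

namespace ChiralEnsemble

/-- `log (1 / |x|)` with values in `(-∞, +∞]`, equal to `+∞` at `x = 0`. -/
def logInv (x : ℝ) : EReal :=
  if x = 0 then ⊤ else ((Real.log (1 / |x|) : ℝ) : EReal)

/-- The potential `Q_δ(t) = t² + 2 δ log (1 / |t|)`, with values in `(-∞, +∞]`.
(For `δ = 0` the product `0 * ⊤` in `EReal` is `0`, so `Q_0(t) = t²` also at `t = 0`.) -/
def Q (δ t : ℝ) : EReal :=
  ((t ^ 2 : ℝ) : EReal) + ((2 * δ : ℝ) : EReal) * logInv t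

/-- The integral of an extended real function, as (integral of the positive part) minus
(integral of the negative part). It is the usual extended integral as soon as one of the two
is finite; in the definition of the energy below the second one is always finite. -/
def extIntegral {X : Type*} [MeasurableSpace X] (m : Measure X) (f : X → EReal) : EReal :=
  ((∫⁻ x, (f x).toENNReal ∂m : ℝ≥0∞) : EReal) - ((∫⁻ x, (-f x).toENNReal ∂m : ℝ≥0∞) : EReal)

/-- The energy
`E_{β,δ}(ν) = β/2 ∫∫ log (1 / |s - t|) ν(ds) ν(dt) + ∫ Q_δ(t) ν(dt)`, with values in `(-∞, +∞]`.
`Q_δ` is bounded below, so `∫ Q_δ dν` always exists in `(-∞, +∞]`. If it is finite, then the double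
integral exists in `(-∞, +∞]`; if it is `+∞`, the energy is `+∞` (this matters only for
measures with tails so heavy that the double integral is `-∞` or not defined). -/
def energy (β δ : ℝ) (ν : Measure ℝ) : EReal :=
  if extIntegral ν (Q δ) = ⊤ then ⊤
  else ((β / 2 : ℝ) : EReal) * extIntegral (ν.prod ν) (fun p : ℝ × ℝ => logInv (p.1 - p.2))
    + extIntegral ν (Q δ)

/-- The equilibrium energy `E*_{β,δ}`: the infimum of the energy over all probability measures. -/
def equilibriumEnergy (β δ : ℝ) : EReal :=
  ⨅ ν : ProbabilityMeasure ℝ, energy β δ (ν : Measure ℝ)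

/-- `ν` is an equilibrium measure: a probability measure whose energy is finite
and equal to the infimum. -/
structure IsEquilibriumMeasure (β δ : ℝ) (ν : Measure ℝ) : Prop where
  isProbabilityMeasure : IsProbabilityMeasure ν
  energy_ne_bot : energy β δ ν ≠ ⊥
  energy_ne_top : energy β δ ν ≠ ⊤
  energy_eq : energy β δ ν = equilibriumEnergy β δ

/-- The inner end point `a` of the support. -/
def endA (β δ : ℝ) : ℝ :=
  √(β / 2) * √(1 + 2 * δ / β - √(1 + 4 * δ / β))

/-- The outer end point `b` of the support. -/
def endB (β δ : ℝ) : ℝ :=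
  √(β / 2) * √(1 + 2 * δ / β + √(1 + 4 * δ / β))

/-- The set `S = [-b, -a] ∪ [a, b]`. -/
def supportSet (β δ : ℝ) : Set ℝ :=
  Set.Icc (-endB β δ) (-endA β δ) ∪ Set.Icc (endA β δ) (endB β δ)

/-- The density `f_{β,δ}`. -/
def density (β δ : ℝ) : ℝ → ℝ :=
  (supportSet β δ).indicator fun t =>
    2 / (Real.pi * β) * (1 / |t|) * √((t ^ 2 - endA β δ ^ 2) * (endB β δ ^ 2 - t ^ 2))

/-- The measure `ν_{β,δ}` with density `f_{β,δ}` with respect to Lebesgue measure. -/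
def nu (β δ : ℝ) : Measure ℝ :=
  volume.withDensity fun t => ENNReal.ofReal (density β δ t)

end ChiralEnsemble

end

/-! A probability measure ν₀ minimises the energy once two facts are known. (i) Euler–Lagrange:
Q_δ(t) − β ∫ log|t − s| ν₀(ds) is constant on the support of ν₀ and at least that constant
elsewhere. (ii) The logarithmic kernel is conditionally positive definite: ∬ log dν dν + ∬ log dν₀
dν₀ ≤ 2 ∬ log dν dν₀. Integrating (i) against ν and against ν₀ and inserting (ii) gives E(ν₀) ≤ E(ν)
(`realEnergy_nu_le`).

For (i), ν₀ is even, so its potential at t is that of its image under squaring, at T = t². Put m =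
(a² + b²)/2 and r = (b² − a²)/2, so that m² = r² + δ². The substitution t² = m + r cos θ turns the
density into a combination of 1, cos θ and a Poisson kernel. Against such a weight, the real part of
a holomorphic function integrates to its value and derivative at 0 and its value at one more point.
With the Joukowski variable T = m + (r/2)(z + 1/z) this gives the potential in closed form
(`squarePotential_eq`). On |z| = 1 the constant is read off; outside, the excess vanishes at the
edge and its derivative is a square over a positive quantity (`excess_nonneg`).

For (ii), −log|s − t| is, up to a constant and an error |s − t|/(2R), an average over centres and
scales of products of interval indicators in s and in t. Such a kernel is positive definite, and R →
∞ removes the error (`two_mul_integral_log_le`).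

Weak convergence is dominated convergence, since the density is explicit and continuous in δ. For
the energies, each equilibrium measure serves as a trial measure at the other parameter; the cost is
|δ − γ| times a uniformly bounded logarithmic moment. -/

namespace ChiralEnsemble

/-- The weight of the image of `ν_{β,δ}` under `t² = m + r cos θ`, up to a constant; for
`m² = r² + δ²` it is equal to `r² sin² θ / (m + r cos θ)`. -/
noncomputable def angleWeight (m r δ θ : ℝ) : ℝ :=
  m - r * Real.cos θ - δ * (δ / (m + r * Real.cos θ))

/-! ### Integrals of holomorphic functions against the weight on the circle -/

section Weight

variable {m r δ : ℝ}

lemma lt_of_sq_eq (hm : 0 < m) (hδ : 0 < δ) (h : m ^ 2 = r ^ 2 + δ ^ 2) : r < m := by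
  nlinarith [sq_nonneg (r - m), mul_pos hδ hδ]

lemma le_of_sq_eq (hm : 0 < m) (h : m ^ 2 = r ^ 2 + δ ^ 2) : r ≤ m :=
  abs_le_of_sq_le_sq' (by nlinarith [sq_nonneg δ]) hm.le |>.2

lemma add_mul_cos_pos (hr : 0 < r) (h : r < m) (θ : ℝ) : 0 < m + r * Real.cos θ := by
  nlinarith [Real.neg_one_le_cos θ]

lemma continuous_angleWeight (hm : 0 < m) (hr : 0 < r) (hδ : 0 ≤ δ) (h : m ^ 2 = r ^ 2 + δ ^ 2) :
    Continuous (angleWeight m r δ) := by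
  unfold angleWeight
  rcases hδ.eq_or_lt with rfl | hδ
  · simp only [zero_mul]; fun_prop
  · have := add_mul_cos_pos hr (lt_of_sq_eq hm hδ h)
    have h' : ∀ θ, m + r * Real.cos θ ≠ 0 := fun θ => (this θ).ne'
    fun_prop (disch := assumption)

/-- With ρ = r/(m + δ), the relation m² = r² + δ² gives 1 − ρ² = 2δ/(m + δ) and |e^{iθ} + ρ|² = 2(m
+ r cos θ)/(m + δ). The rational part of the weight is thus a Poisson kernel at −ρ. -/
lemma poissonKernel_circleMap (hm : 0 < m) (hr : 0 < r) (hδ : 0 < δ) (h : m ^ 2 = r ^ 2 + δ ^ 2)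
    (θ : ℝ) : poissonKernel 0 ((-(r / (m + δ)) : ℝ) : ℂ) (circleMap 0 1 θ)
      = δ / (m + r * Real.cos θ) := by
  have h1 := add_mul_cos_pos hr (lt_of_sq_eq hm hδ h) θ
  have h2 : 0 < m + δ := by positivity
  have e1 : ‖circleMap 0 1 θ‖ = 1 := by simp
  have e2 : ‖circleMap 0 1 θ - ((-(r / (m + δ)) : ℝ) : ℂ)‖ ^ 2
      = 2 * (m + r * Real.cos θ) / (m + δ) := by
    rw [← Complex.normSq_eq_norm_sq, Complex.normSq_apply]
    simp only [circleMap, Complex.ofReal_one, one_mul, zero_add, Complex.sub_re, Complex.sub_im,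
      Complex.exp_ofReal_mul_I_re, Complex.exp_ofReal_mul_I_im, Complex.ofReal_re,
      Complex.ofReal_im]
    have : Real.sin θ ^ 2 = 1 - Real.cos θ ^ 2 := Real.sin_sq θ
    field_simp
    linear_combination (m + δ) ^ 2 * this - h
  rw [poissonKernel_def, sub_zero, sub_zero, e2, e1, Complex.norm_real, Real.norm_eq_abs, sq_abs,
    div_eq_div_iff (by positivity) h1.ne']
  field_simp
  linear_combination h

lemma circleAverage_zero_one_eq {f : ℂ → ℂ} (hf : DiffContOnCl ℂ f (Metric.ball 0 1)) :
    Real.circleAverage f 0 1 = f 0 :=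
  DiffContOnCl.circleAverage (by rwa [abs_one])

/-- On the unit circle 2 cos θ · f = f/z + z f. The mean value property kills z f and leaves f′(0)
from f/z, after splitting off the pole f(0)/z. -/
lemma circleAverage_re_mul_cos {f : ℂ → ℂ} (hf : DiffContOnCl ℂ f (Metric.ball 0 1)) :
    (2 * Real.pi)⁻¹ * ∫ θ in (0 : ℝ)..2 * Real.pi, (f (circleMap 0 1 θ)).re * Real.cos θ
      = (deriv f 0).re / 2 := by
  have hcl : closure (Metric.ball (0 : ℂ) 1) = Metric.closedBall 0 1 :=
    closure_ball _ one_ne_zero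
  have hnhds : Metric.ball (0 : ℂ) 1 ∈ 𝓝 0 := Metric.ball_mem_nhds _ one_pos
  have hcont : ContinuousOn f (Metric.closedBall 0 1) := hcl ▸ hf.2
  have hf0 : DifferentiableAt ℂ f 0 := hf.1.differentiableAt hnhds
  have hg : DiffContOnCl ℂ (dslope f 0) (Metric.ball 0 1) := by
    refine ⟨(Complex.differentiableOn_dslope hnhds).2 hf.1, ?_⟩
    rw [hcl, continuousOn_dslope (mem_of_superset hnhds Metric.ball_subset_closedBall)]
    exact ⟨hcont, hf0⟩
  have hI : DiffContOnCl ℂ (fun z => z * f z) (Metric.ball 0 1) :=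
    differentiable_id.diffContOnCl.smul hf
  have a1 := circleAverage_zero_one_eq hg
  have a2 := circleAverage_zero_one_eq hI
  -- Inversion preserves averages over the unit circle, so this is the mean value property of `z * f
  -- 0`.
  have a3 : Real.circleAverage (fun z : ℂ => z⁻¹ * f 0) 0 1 = 0 := by
    have := circleAverage_zero_one_eq (f := fun z => z * f 0)
      (differentiable_id.mul_const (f 0)).diffContOnCl
    rw [← Real.circleAverage_zero_one_congr_inv] at this
    simpa using this
  rw [dslope_same] at a1
  simp only [zero_mul] at a2
  have hne : ∀ θ : ℝ, circleMap 0 1 θ ≠ 0 := fun θ => circleMap_ne_center one_ne_zero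
  have c1 : CircleIntegrable (dslope f 0) 0 1 :=
    (hg.2.mono (by rw [hcl]; exact Metric.sphere_subset_closedBall)).circleIntegrable zero_le_one
  have c2 : CircleIntegrable (fun z => z * f z) 0 1 :=
    (hI.2.mono (by rw [hcl]; exact Metric.sphere_subset_closedBall)).circleIntegrable zero_le_one
  have c3 : CircleIntegrable (fun z => z⁻¹ * f 0) 0 1 := by
    refine ContinuousOn.circleIntegrable zero_le_one ?_
    refine ContinuousOn.mul (continuousOn_inv₀.mono fun z hz => ?_) continuousOn_const
    rintro rfl; simp at hz
  have key : Real.circleAverage (fun z => dslope f 0 z + z⁻¹ * f 0 + z * f z) 0 1 = deriv f 0 := by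
    rw [Real.circleAverage_fun_add (f₁ := fun z => dslope f 0 z + z⁻¹ * f 0) (c1.add c3) c2,
      Real.circleAverage_fun_add c1 c3, a1, a2, a3]
    simp
  have key2 := Complex.reCLM.circleAverage_comp_comm (f := fun z =>
    dslope f 0 z + z⁻¹ * f 0 + z * f z) (c := 0) (R := 1) ((c1.add c3).add c2)
  rw [key] at key2
  simp only [Complex.reCLM_apply] at key2
  rw [← key2, Real.circleAverage_def, smul_eq_mul, mul_div_assoc, ← intervalIntegral.integral_div]
  congr 1
  refine intervalIntegral.integral_congr fun θ _ => ?_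
  simp only [Function.comp_apply, Complex.reCLM_apply]
  have e : dslope f 0 (circleMap 0 1 θ) + (circleMap 0 1 θ)⁻¹ * f 0
      + circleMap 0 1 θ * f (circleMap 0 1 θ) = (2 * Real.cos θ : ℝ) * f (circleMap 0 1 θ) := by
    rw [dslope_of_ne _ (hne θ), slope_def_field, sub_zero]
    have h1 : circleMap 0 1 θ + (circleMap 0 1 θ)⁻¹ = (2 * Real.cos θ : ℝ) := by
      rw [circleMap_zero_inv]
      simp only [circleMap, Complex.ofReal_one, inv_one, one_mul, zero_add]
      push_cast
      rw [Complex.cos]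
      ring
    rw [← h1]
    have := hne θ
    field_simp
    ring
  rw [e, Complex.re_ofReal_mul]
  ring

/-- The three terms of the weight call for the mean value property, the first Taylor coefficient and
the Poisson formula. -/
lemma circleAverage_re_mul_angleWeight (hm : 0 < m) (hr : 0 < r) (hδ : 0 ≤ δ)
    (h : m ^ 2 = r ^ 2 + δ ^ 2) {f : ℂ → ℂ} (hf : DiffContOnCl ℂ f (Metric.ball 0 1)) :
    (2 * Real.pi)⁻¹ * ∫ θ in (0 : ℝ)..2 * Real.pi, (f (circleMap 0 1 θ)).re * angleWeight m r δ θ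
      = m * (f 0).re - r / 2 * (deriv f 0).re - δ * (f ((-(r / (m + δ)) : ℝ) : ℂ)).re := by
  have hcl : closure (Metric.ball (0 : ℂ) 1) = Metric.closedBall 0 1 :=
    closure_ball _ one_ne_zero
  have hcont : ContinuousOn f (Metric.closedBall 0 1) := hcl ▸ hf.2
  have hcontθ : Continuous fun θ : ℝ => (f (circleMap 0 1 θ)).re :=
    Complex.continuous_re.comp (hcont.comp_continuous (continuous_circleMap 0 1) fun θ => by simp)
  have cint : CircleIntegrable f 0 1 :=
    (hcont.mono Metric.sphere_subset_closedBall).circleIntegrable zero_le_one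
  have a1 : (2 * Real.pi)⁻¹ * ∫ θ in (0 : ℝ)..2 * Real.pi, (f (circleMap 0 1 θ)).re = (f 0).re := by
    have := circleAverage_zero_one_eq hf
    rw [← this, ← Complex.reCLM_apply, ← Complex.reCLM.circleAverage_comp_comm cint,
      Real.circleAverage_def]
    rfl
  have a2 := circleAverage_re_mul_cos hf
  have a3 : (2 * Real.pi)⁻¹ * ∫ θ in (0 : ℝ)..2 * Real.pi,
      (f (circleMap 0 1 θ)).re * (δ * (δ / (m + r * Real.cos θ)))
        = δ * (f ((-(r / (m + δ)) : ℝ) : ℂ)).re := by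
    -- For δ = 0 one has r = m and the Poisson point −1 lies on the circle, but its coefficient is
    -- 0.
    rcases hδ.eq_or_lt with rfl | hδ
    · simp
    have hρ : ((-(r / (m + δ)) : ℝ) : ℂ) ∈ Metric.ball (0 : ℂ) 1 := by
      rw [mem_ball_zero_iff, Complex.norm_real, Real.norm_eq_abs, abs_neg,
        abs_of_pos (by positivity), div_lt_one (by positivity)]
      linarith [lt_of_sq_eq hm hδ h]
    have hp := hf.circleAverage_poissonKernel_smul hρ
    have hc : CircleIntegrable (poissonKernel 0 ((-(r / (m + δ)) : ℝ) : ℂ) • f) 0 1 := by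
      refine ContinuousOn.circleIntegrable zero_le_one
        (ContinuousOn.smul ?_ (hcont.mono Metric.sphere_subset_closedBall))
      rw [poissonKernel_eq_re_herglotzRieszKernel]
      have := continuousOn_herglotzRieszKernel_sphere hρ
      rw [abs_one] at this
      exact Complex.continuous_re.comp_continuousOn this
    rw [← hp, ← Complex.reCLM_apply, ← Complex.reCLM.circleAverage_comp_comm hc,
      Real.circleAverage_def, smul_eq_mul, ← mul_assoc, mul_comm δ, mul_assoc,
      ← intervalIntegral.integral_const_mul δ]
    congr 1
    refine intervalIntegral.integral_congr fun θ _ => ?_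
    simp only [Function.comp_apply, Pi.smul_apply', Complex.reCLM_apply,
      poissonKernel_circleMap hm hr hδ h, Complex.real_smul, Complex.re_ofReal_mul]
    ring
  have hcW : Continuous fun θ => δ * (δ / (m + r * Real.cos θ)) := by
    rcases hδ.eq_or_lt with rfl | hδ
    · simp only [zero_mul]; fun_prop
    · have h' : ∀ θ, m + r * Real.cos θ ≠ 0 :=
        fun θ => (add_mul_cos_pos hr (lt_of_sq_eq hm hδ h) θ).ne'
      fun_prop (disch := assumption)
  have e : ∀ θ, (f (circleMap 0 1 θ)).re * angleWeight m r δ θ = m * (f (circleMap 0 1 θ)).re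
      - r * ((f (circleMap 0 1 θ)).re * Real.cos θ)
      - (f (circleMap 0 1 θ)).re * (δ * (δ / (m + r * Real.cos θ))) := fun θ => by
    unfold angleWeight; ring
  simp only [e]
  rw [intervalIntegral.integral_sub, intervalIntegral.integral_sub,
    intervalIntegral.integral_const_mul, intervalIntegral.integral_const_mul, mul_sub, mul_sub, a3,
    mul_left_comm, a1, mul_left_comm, a2]
  · ring
  all_goals exact Continuous.intervalIntegrable (by fun_prop) _ _

end Weight

/-! ### The logarithmic potential in the Joukowski variable -/

section LogPotential

variable {m r δ : ℝ}

lemma circleAverage_angleWeight (hm : 0 < m) (hr : 0 < r) (hδ : 0 ≤ δ)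
    (h : m ^ 2 = r ^ 2 + δ ^ 2) :
    (2 * Real.pi)⁻¹ * ∫ θ in (0 : ℝ)..2 * Real.pi, angleWeight m r δ θ = m - δ := by
  have := circleAverage_re_mul_angleWeight hm hr hδ h (f := fun _ => 1) diffContOnCl_const
  simpa using this

/-- For |z| > 1 the function w ↦ log(1 − w/z) + log|z| is holomorphic near the closed disc, has real
part log|z − w| there, and has derivative −1/z at 0. -/
lemma circleAverage_log_mul_angleWeight_of_one_lt (hm : 0 < m) (hr : 0 < r) (hδ : 0 ≤ δ)
    (h : m ^ 2 = r ^ 2 + δ ^ 2) {z : ℂ} (hz : 1 < ‖z‖) :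
    (2 * Real.pi)⁻¹ * ∫ θ in (0 : ℝ)..2 * Real.pi,
        Real.log ‖z - circleMap 0 1 θ‖ * angleWeight m r δ θ
      = (m - δ) * Real.log ‖z‖ + r / 2 * (z⁻¹).re
        - δ * Real.log ‖1 + ((r / (m + δ) : ℝ) : ℂ) * z⁻¹‖ := by
  have hz0 : z ≠ 0 := by rintro rfl; simp at hz; linarith
  have hzp : 0 < ‖z‖ := norm_pos_iff.2 hz0
  have hslit : ∀ w : ℂ, ‖w‖ ≤ 1 → 1 - w * z⁻¹ ∈ Complex.slitPlane := fun w hw => by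
    left
    have h1 : ‖w * z⁻¹‖ < 1 := by
      rw [norm_mul, norm_inv, ← div_eq_mul_inv, div_lt_one hzp]
      linarith
    have := (Complex.re_le_norm (w * z⁻¹))
    rw [Complex.sub_re, Complex.one_re]
    linarith
  have hda : ∀ w : ℂ, ‖w‖ ≤ 1 →
      HasDerivAt (fun w => Complex.log (1 - w * z⁻¹) + ((Real.log ‖z‖ : ℝ) : ℂ))
        (-z⁻¹ / (1 - w * z⁻¹)) w := fun w hw => by
    have h1 : HasDerivAt (fun w : ℂ => 1 - w * z⁻¹) (-z⁻¹) w := by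
      simpa using ((hasDerivAt_id w).mul_const z⁻¹).const_sub 1
    exact (h1.clog (hslit w hw)).add_const _
  have hf : DiffContOnCl ℂ (fun w => Complex.log (1 - w * z⁻¹) + ((Real.log ‖z‖ : ℝ) : ℂ))
      (Metric.ball 0 1) := by
    refine DifferentiableOn.diffContOnCl ?_
    rw [closure_ball _ one_ne_zero]
    intro w hw
    exact (hda w (by simpa using hw)).differentiableAt.differentiableWithinAt
  have key := circleAverage_re_mul_angleWeight hm hr hδ h hf
  have hre : ∀ w : ℂ, ‖w‖ ≤ 1 →
      (Complex.log (1 - w * z⁻¹) + ((Real.log ‖z‖ : ℝ) : ℂ)).re = Real.log ‖z - w‖ :=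
    fun w hw => by
    rw [Complex.add_re, Complex.log_re, Complex.ofReal_re, ← Real.log_mul _ hzp.ne', ← norm_mul,
      sub_mul, one_mul, mul_assoc, inv_mul_cancel₀ hz0, mul_one]
    exact norm_ne_zero_iff.2 (Complex.slitPlane_ne_zero (hslit w hw))
  have e : ∀ θ, (Complex.log (1 - circleMap 0 1 θ * z⁻¹) + ((Real.log ‖z‖ : ℝ) : ℂ)).re
      = Real.log ‖z - circleMap 0 1 θ‖ := fun θ => hre _ (by simp)
  simp only [e] at key
  have hρ : ‖((-(r / (m + δ)) : ℝ) : ℂ)‖ ≤ 1 := by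
    rw [Complex.norm_real, Real.norm_eq_abs, abs_neg, abs_of_pos (by positivity),
      div_le_one (by positivity)]
    linarith [le_of_sq_eq hm h]
  rw [key, (hda 0 (by simp)).deriv]
  simp only [zero_mul, sub_zero, Complex.log_one, zero_add, Complex.ofReal_re, div_one,
    Complex.neg_re, Complex.add_re, Complex.log_re, Complex.ofReal_neg, neg_mul, sub_neg_eq_add]
  ring

/-- The difference of the squares is (s − 1)(s + 1 − 2 Re(z w̄)), a product of nonnegative factors.
This dominates the logarithm when the circle is approached radially from outside. -/
lemma norm_sub_le_norm_smul_sub {z w : ℂ} (hz : ‖z‖ = 1) (hw : ‖w‖ = 1) {s : ℝ} (hs : 1 ≤ s) :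
    ‖z - w‖ ≤ ‖(s : ℂ) * z - w‖ := by
  refine le_of_sq_le_sq ?_ (norm_nonneg _)
  have h1 : z.re ^ 2 + z.im ^ 2 = 1 := by
    have := Complex.sq_norm z; rw [hz, Complex.normSq_apply] at this; linarith
  have h2 : w.re ^ 2 + w.im ^ 2 = 1 := by
    have := Complex.sq_norm w; rw [hw, Complex.normSq_apply] at this; linarith
  rw [Complex.sq_norm, Complex.sq_norm, Complex.normSq_apply, Complex.normSq_apply]
  simp only [Complex.sub_re, Complex.sub_im, Complex.re_ofReal_mul, Complex.im_ofReal_mul]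
  have h3 : z.re * w.re + z.im * w.im ≤ 1 := by
    nlinarith [sq_nonneg (z.re - w.re), sq_nonneg (z.im - w.im)]
  have e : (s * z.re - w.re) * (s * z.re - w.re) + (s * z.im - w.im) * (s * z.im - w.im)
      - ((z.re - w.re) * (z.re - w.re) + (z.im - w.im) * (z.im - w.im))
      = (s - 1) * (s + 1 - 2 * (z.re * w.re + z.im * w.im)) := by
    linear_combination (s ^ 2 - 1) * h1
  nlinarith [mul_nonneg (sub_nonneg.2 hs) (by linarith :
    0 ≤ s + 1 - 2 * (z.re * w.re + z.im * w.im))]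

lemma intervalIntegrable_log_norm_sub_circleMap (z : ℂ) :
    IntervalIntegrable (fun θ => Real.log ‖z - circleMap 0 1 θ‖) volume 0 (2 * Real.pi) := by
  have := circleIntegrable_log_norm_sub_const (a := z) (c := 0) 1
  simpa only [CircleIntegrable, norm_sub_rev z] using this

/-- The case |z| = 1 is needed for points of the support; it is the limit s ↓ 1 of the previous
formula at s z. -/
lemma circleAverage_log_mul_angleWeight (hm : 0 < m) (hr : 0 < r) (hδ : 0 ≤ δ)
    (h : m ^ 2 = r ^ 2 + δ ^ 2) {z : ℂ} (hz : 1 ≤ ‖z‖) :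
    (2 * Real.pi)⁻¹ * ∫ θ in (0 : ℝ)..2 * Real.pi,
        Real.log ‖z - circleMap 0 1 θ‖ * angleWeight m r δ θ
      = (m - δ) * Real.log ‖z‖ + r / 2 * (z⁻¹).re
        - δ * Real.log ‖1 + ((r / (m + δ) : ℝ) : ℂ) * z⁻¹‖ := by
  rcases hz.eq_or_lt with hz | hz
  swap
  · exact circleAverage_log_mul_angleWeight_of_one_lt hm hr hδ h hz
  replace hz := hz.symm
  have hz0 : z ≠ 0 := by rintro rfl; simp at hz
  have hs0 : ∀ᶠ s : ℝ in 𝓝[>] 1, 1 < s ∧ s < 2 := by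
    filter_upwards [Ioo_mem_nhdsGT (show (1 : ℝ) < 2 by norm_num)] with s hs using hs
  have hWc := continuous_angleWeight hm hr hδ h
  have hlim : Tendsto (fun s : ℝ => ((s : ℂ) * z)) (𝓝[>] 1) (𝓝 z) := by
    have : Continuous fun s : ℝ => (s : ℂ) * z := by fun_prop
    simpa using (this.tendsto 1).mono_left nhdsWithin_le_nhds
  have hL : Tendsto (fun s : ℝ => (2 * Real.pi)⁻¹ * ∫ θ in (0 : ℝ)..2 * Real.pi,
        Real.log ‖(s : ℂ) * z - circleMap 0 1 θ‖ * angleWeight m r δ θ) (𝓝[>] 1)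
      (𝓝 ((2 * Real.pi)⁻¹ * ∫ θ in (0 : ℝ)..2 * Real.pi,
        Real.log ‖z - circleMap 0 1 θ‖ * angleWeight m r δ θ)) := by
    refine Tendsto.const_mul _ ?_
    have hnull : ∀ᵐ θ : ℝ ∂volume, circleMap 0 1 θ ≠ z := by
      have := (Set.countable_singleton z).preimage_circleMap 0 one_ne_zero
      filter_upwards [this.ae_notMem volume] with θ hθ using hθ
    refine intervalIntegral.tendsto_integral_filter_of_dominated_convergence
      (fun θ => (|Real.log ‖z - circleMap 0 1 θ‖| + Real.log 3) * |angleWeight m r δ θ|) ?_ ?_ ?_ ?_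
    · refine Eventually.of_forall fun s => Measurable.aestronglyMeasurable ?_
      have := continuous_circleMap 0 1
      exact (Real.measurable_log.comp (by fun_prop)).mul hWc.measurable
    · filter_upwards [hs0] with s hs
      filter_upwards [hnull] with θ hθ _
      rw [Real.norm_eq_abs, abs_mul]
      refine mul_le_mul_of_nonneg_right ?_ (abs_nonneg _)
      have h1 := norm_sub_le_norm_smul_sub hz (w := circleMap 0 1 θ) (by simp) hs.1.le
      have h0 : 0 < ‖z - circleMap 0 1 θ‖ := norm_pos_iff.2 (sub_ne_zero.2 hθ.symm)
      have h2 : ‖(s : ℂ) * z - circleMap 0 1 θ‖ ≤ 3 := by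
        refine (norm_sub_le _ _).trans ?_
        rw [norm_mul, hz, Complex.norm_real, Real.norm_eq_abs, abs_of_pos (by linarith)]
        simp only [mul_one, norm_circleMap_zero, abs_one]
        linarith
      have h3 := Real.log_le_log h0 h1
      have h4 := Real.log_le_log (h0.trans_le h1) h2
      have h5 : 0 ≤ Real.log 3 := Real.log_nonneg (by norm_num)
      rw [abs_le]
      constructor
      · linarith [neg_abs_le (Real.log ‖z - circleMap 0 1 θ‖)]
      · linarith [abs_nonneg (Real.log ‖z - circleMap 0 1 θ‖)]
    · have h1 := (intervalIntegrable_log_norm_sub_circleMap z).abs.add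
        (intervalIntegrable_const (c := Real.log 3))
      exact h1.mul_continuousOn hWc.abs.continuousOn
    · filter_upwards [hnull] with θ hθ _
      refine Tendsto.mul_const _ ?_
      refine Tendsto.log ((hlim.sub_const _).norm) ?_
      exact norm_ne_zero_iff.2 (sub_ne_zero.2 hθ.symm)
  have hR : Tendsto (fun s : ℝ => (m - δ) * Real.log ‖(s : ℂ) * z‖ + r / 2 * (((s : ℂ) * z)⁻¹).re
        - δ * Real.log ‖1 + ((r / (m + δ) : ℝ) : ℂ) * ((s : ℂ) * z)⁻¹‖) (𝓝[>] 1)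
      (𝓝 ((m - δ) * Real.log ‖z‖ + r / 2 * (z⁻¹).re
        - δ * Real.log ‖1 + ((r / (m + δ) : ℝ) : ℂ) * z⁻¹‖)) := by
    have hinv := hlim.inv₀ hz0
    refine ((Tendsto.log hlim.norm (by simpa using hz0)).const_mul _ |>.add
      (((Complex.continuous_re.tendsto _).comp hinv).const_mul _)).sub ?_
    -- For δ > 0, r/(m + δ) < 1 keeps the argument of the logarithm nonzero. For δ = 0 it may vanish
    -- at z = −1, but the term is absent.
    rcases hδ.eq_or_lt with rfl | hδ
    · simp
    refine (Tendsto.log ((hinv.const_mul _).const_add _).norm ?_).const_mul _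
    rw [norm_ne_zero_iff]
    intro h0
    have h1 : ‖((r / (m + δ) : ℝ) : ℂ) * z⁻¹‖ = 1 := by
      rw [← norm_neg, ← eq_neg_of_add_eq_zero_left h0, norm_one]
    rw [norm_mul, norm_inv, hz, inv_one, mul_one, Complex.norm_real, Real.norm_eq_abs,
      abs_of_pos (by positivity), div_eq_one_iff_eq (by positivity)] at h1
    linarith [lt_of_sq_eq hm hδ h]
  refine tendsto_nhds_unique hL (hR.congr' ?_)
  filter_upwards [hs0] with s hs
  refine (circleAverage_log_mul_angleWeight_of_one_lt hm hr hδ h ?_).symm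
  rw [norm_mul, hz, Complex.norm_real, Real.norm_eq_abs, abs_of_pos (by linarith [hs.1])]
  linarith [hs.1]

/-- The logarithmic potential at `T` of the image under `t ↦ t²` of `ν_{β,δ}`, up to a constant. -/
noncomputable def squarePotential (m r δ T : ℝ) : ℝ :=
  (2 * Real.pi)⁻¹ * ∫ θ in (0 : ℝ)..2 * Real.pi,
    Real.log |T - (m + r * Real.cos θ)| * angleWeight m r δ θ

/-- For w = e^{iθ}, T − (m + r cos θ) = (r/2)(z − w)(z − w̄)/z, and |z − w̄| = |z̄ − w|. So the
logarithm splits into a constant and two circle potentials, at z and at z̄. -/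
lemma squarePotential_eq (hm : 0 < m) (hr : 0 < r) (hδ : 0 ≤ δ) (h : m ^ 2 = r ^ 2 + δ ^ 2)
    {z : ℂ} (hz : 1 ≤ ‖z‖) {T : ℝ} (hT : (T : ℂ) = m + r / 2 * (z + z⁻¹)) :
    squarePotential m r δ T = (m - δ) * (Real.log (r / 2) + Real.log ‖z‖) + r * (z⁻¹).re
      - 2 * δ * Real.log ‖1 + ((r / (m + δ) : ℝ) : ℂ) * z⁻¹‖ := by
  have hz0 : z ≠ 0 := by rintro rfl; simp at hz; linarith
  have hWc := continuous_angleWeight hm hr hδ h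
  have k1 := circleAverage_log_mul_angleWeight hm hr hδ h hz
  have k2 := circleAverage_log_mul_angleWeight hm hr hδ h
    (z := starRingEnd ℂ z) (by simpa using hz)
  have e2 : ‖1 + ((r / (m + δ) : ℝ) : ℂ) * (starRingEnd ℂ z)⁻¹‖
      = ‖1 + ((r / (m + δ) : ℝ) : ℂ) * z⁻¹‖ := by
    rw [← Complex.norm_conj]
    simp
  rw [RCLike.norm_conj, e2, ← map_inv₀, Complex.conj_re] at k2
  have k0 := circleAverage_angleWeight hm hr hδ h
  have i1 := (intervalIntegrable_log_norm_sub_circleMap z).mul_continuousOn hWc.continuousOn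
  have i2 := (intervalIntegrable_log_norm_sub_circleMap (starRingEnd ℂ z)).mul_continuousOn
    hWc.continuousOn
  have i0 : IntervalIntegrable (fun θ => (Real.log (r / 2) - Real.log ‖z‖) * angleWeight m r δ θ)
    volume 0 (2 * Real.pi) := (hWc.const_mul _).intervalIntegrable _ _
  have key : ∫ θ in (0 : ℝ)..2 * Real.pi,
      Real.log |T - (m + r * Real.cos θ)| * angleWeight m r δ θ
      = ∫ θ in (0 : ℝ)..2 * Real.pi, ((Real.log (r / 2) - Real.log ‖z‖) * angleWeight m r δ θ
        + Real.log ‖z - circleMap 0 1 θ‖ * angleWeight m r δ θ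
        + Real.log ‖starRingEnd ℂ z - circleMap 0 1 θ‖ * angleWeight m r δ θ) := by
    -- The splitting of the logarithm needs w ≠ z and w ≠ z̄, which excludes only countably many θ.
    refine intervalIntegral.integral_congr_ae ?_
    have n1 := (Set.countable_singleton z).preimage_circleMap 0 one_ne_zero
    have n2 := (Set.countable_singleton (starRingEnd ℂ z)).preimage_circleMap 0 one_ne_zero
    filter_upwards [n1.ae_notMem volume, n2.ae_notMem volume] with θ h1 h2 _
    rw [← add_mul, ← add_mul]
    congr 1
    have h1' : ‖z - circleMap 0 1 θ‖ ≠ 0 := norm_ne_zero_iff.2 (sub_ne_zero.2 (Ne.symm h1))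
    have h2' : ‖starRingEnd ℂ z - circleMap 0 1 θ‖ ≠ 0 :=
      norm_ne_zero_iff.2 (sub_ne_zero.2 (Ne.symm h2))
    have hzn : ‖z‖ ≠ 0 := norm_ne_zero_iff.2 hz0
    rw [← Real.log_div (by positivity) hzn, ← Real.log_mul (by positivity) h1',
      ← Real.log_mul (by positivity) h2']
    congr 1
    have hw : circleMap 0 1 θ * (starRingEnd ℂ) (circleMap 0 1 θ) = 1 := by
      rw [Complex.mul_conj, Complex.normSq_eq_norm_sq]; simp
    have hc : ((2 * Real.cos θ : ℝ) : ℂ) = circleMap 0 1 θ + (starRingEnd ℂ) (circleMap 0 1 θ) := by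
      rw [Complex.add_conj]
      simp [circleMap, Complex.exp_ofReal_mul_I_re, -Complex.ofReal_cos]
    rw [← Complex.norm_conj (starRingEnd ℂ z - _), map_sub, Complex.conj_conj, ← Real.norm_eq_abs,
      ← Complex.norm_real, div_mul_eq_mul_div, div_mul_eq_mul_div, eq_div_iff hzn, ← norm_mul]
    rw [show r / 2 = ‖((r / 2 : ℝ) : ℂ)‖ by
      rw [Complex.norm_real, Real.norm_eq_abs, abs_of_pos (by positivity)], ← norm_mul, ← norm_mul]
    congr 1
    have : ((T - (m + r * Real.cos θ) : ℝ) : ℂ)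
        = r / 2 * (z + z⁻¹ - ((2 * Real.cos θ : ℝ) : ℂ)) := by
      push_cast
      rw [hT]; ring
    rw [this, hc]
    push_cast
    field_simp
    linear_combination -(r : ℂ) * hw
  rw [squarePotential, key, intervalIntegral.integral_add (i0.add i1) i2,
    intervalIntegral.integral_add i0 i1, intervalIntegral.integral_const_mul]
  rw [mul_add, mul_add, k1, k2, mul_left_comm, k0]
  ring

end LogPotential

/-! ### Euler–Lagrange conditions for the squared variable -/

section EulerLagrange

variable {m r δ : ℝ}

/-- The value on the support of `T - δ log T - squarePotential m r δ T`. -/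
noncomputable def lagrangeConst (m r δ : ℝ) : ℝ :=
  m - δ * Real.log ((m + δ) / 2) - (m - δ) * Real.log (r / 2)

/-- Here z = e^{iφ} and T = m + r cos φ = ((m + δ)/2)|1 + ρ z̄|² with ρ = r/(m + δ), so δ log T
cancels the last term of the potential up to a constant. -/
lemma sub_squarePotential_eq_of_mem (hm : 0 < m) (hr : 0 < r) (hδ : 0 ≤ δ)
    (h : m ^ 2 = r ^ 2 + δ ^ 2) {T : ℝ} (hT : T ∈ Set.Icc (m - r) (m + r)) :
    T - δ * Real.log T - squarePotential m r δ T = lagrangeConst m r δ := by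
  obtain ⟨φ, hφ⟩ : ∃ φ, T = m + r * Real.cos φ := by
    refine ⟨Real.arccos ((T - m) / r), ?_⟩
    rw [Real.cos_arccos]
    · field_simp; ring
    · rw [le_div_iff₀ hr]; linarith [hT.1]
    · rw [div_le_iff₀ hr]; linarith [hT.2]
  set z : ℂ := circleMap 0 1 φ with hz
  have hzn : ‖z‖ = 1 := by simp [z]
  have hre : z.re = Real.cos φ := by simp [z, circleMap, Complex.exp_ofReal_mul_I_re]
  have him : z.im = Real.sin φ := by simp [z, circleMap, Complex.exp_ofReal_mul_I_im]
  have hinv : z⁻¹ = starRingEnd ℂ z := by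
    rw [Complex.inv_def, Complex.normSq_eq_norm_sq, hzn]; simp
  have hTz : (T : ℂ) = m + r / 2 * (z + z⁻¹) := by
    rw [hinv, Complex.add_conj, hre, hφ]; push_cast; ring
  rw [squarePotential_eq hm hr hδ h hzn.ge hTz, hzn, Real.log_one, hinv, Complex.conj_re, hre,
    lagrangeConst]
  suffices hlog : δ * Real.log T = δ * Real.log ((m + δ) / 2)
      + 2 * δ * Real.log ‖1 + ((r / (m + δ) : ℝ) : ℂ) * starRingEnd ℂ z‖ by
    rw [hlog, hφ]; ring
  rcases hδ.eq_or_lt with rfl | hδ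
  · simp
  have hTpos : 0 < T := hφ ▸ add_mul_cos_pos hr (lt_of_sq_eq hm hδ h) φ
  have hsq : T = (m + δ) / 2 * ‖1 + ((r / (m + δ) : ℝ) : ℂ) * starRingEnd ℂ z‖ ^ 2 := by
    rw [Complex.sq_norm, Complex.normSq_apply]
    simp only [Complex.add_re, Complex.add_im, Complex.re_ofReal_mul, Complex.im_ofReal_mul,
      Complex.conj_re, Complex.conj_im, hre, him, Complex.one_re, Complex.one_im]
    have : Real.sin φ ^ 2 = 1 - Real.cos φ ^ 2 := Real.sin_sq φ
    rw [hφ]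
    field_simp
    linear_combination h - r ^ 2 * this
  have hne : ‖1 + ((r / (m + δ) : ℝ) : ℂ) * starRingEnd ℂ z‖ ≠ 0 := by
    intro h0
    rw [h0] at hsq
    simp at hsq
    linarith
  conv_lhs => rw [hsq]
  rw [Real.log_mul (by positivity) (pow_ne_zero 2 hne), Real.log_pow]
  push_cast
  ring

lemma exists_add_inv_eq {u : ℝ} (hu : 1 ≤ u) : ∃ y : ℝ, 1 ≤ y ∧ y + y⁻¹ = 2 * u := by
  have h0 : 0 ≤ u ^ 2 - 1 := by nlinarith
  have h1 := Real.sqrt_nonneg (u ^ 2 - 1)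
  refine ⟨u + √(u ^ 2 - 1), by linarith, ?_⟩
  have : (u + √(u ^ 2 - 1))⁻¹ = u - √(u ^ 2 - 1) := by
    refine inv_eq_of_mul_eq_one_right ?_
    linear_combination -Real.sq_sqrt h0
  rw [this]; ring

/-- Off the support, the excess of `T - δ log T - squarePotential m r δ T` over its value on the
support, for `T = m + e (r / 2) (y + y⁻¹)` with `e = ±1` and `y ≥ 1`. -/
lemma excess_nonneg (hm : 0 < m) (hr : 0 < r) (hδ : 0 ≤ δ) (h : m ^ 2 = r ^ 2 + δ ^ 2)
    {e y : ℝ} (he : e ^ 2 = 1) (hy : 1 ≤ y) (hpos : 0 < 1 + e * (r / (m + δ)) * y) :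
    0 ≤ e * (r / 2) * (y - y⁻¹) + δ * (Real.log (y + e * (r / (m + δ)))
      - Real.log (1 + e * (r / (m + δ)) * y)) - m * Real.log y := by
  set ρ := r / (m + δ) with hρ
  have hρ0 : 0 < ρ := by positivity
  have hρ1 : ρ ≤ 1 := (div_le_one (by positivity)).2 (by linarith [le_of_sq_eq hm h])
  have he' : e = 1 ∨ e = -1 := mul_self_eq_one_iff.1 (by rw [← sq, he])
  have hB : ∀ x ∈ Set.Icc 1 y, 0 < 1 + e * ρ * x := by
    intro x hx
    rcases he' with rfl | rfl
    · nlinarith [hx.1]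
    · nlinarith [hx.2]
  have hA : ∀ x ∈ Set.Icc 1 y, 0 < x + e * ρ := by
    intro x hx
    have := hB 1 ⟨le_rfl, hy⟩
    linarith [hx.1]
  have hder : ∀ x ∈ Set.Icc 1 y, HasDerivAt (fun y => e * (r / 2) * (y - y⁻¹)
      + δ * (Real.log (y + e * ρ) - Real.log (1 + e * ρ * y)) - m * Real.log y)
      (e * (r / 2) * (1 - -(x ^ 2)⁻¹) + δ * (1 / (x + e * ρ) - e * ρ * 1 / (1 + e * ρ * x))
        - m * x⁻¹) x := by
    intro x hx
    have hx0 : x ≠ 0 := by linarith [hx.1]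
    refine ((((hasDerivAt_id x).sub (hasDerivAt_inv hx0)).const_mul _).add
      (((((hasDerivAt_id x).add_const _).log (hA x hx).ne').sub
      ((((hasDerivAt_id x).const_mul _).const_add _).log (hB x hx).ne')).const_mul _)).sub
      ((Real.hasDerivAt_log hx0).const_mul _)
  have hmono : MonotoneOn (fun y => e * (r / 2) * (y - y⁻¹)
      + δ * (Real.log (y + e * ρ) - Real.log (1 + e * ρ * y)) - m * Real.log y)
      (Set.Icc 1 y) := by
    refine monotoneOn_of_deriv_nonneg (convex_Icc 1 y)
      (fun x hx => (hder x hx).continuousAt.continuousWithinAt)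
      (fun x hx => (hder x (interior_subset hx)).differentiableAt.differentiableWithinAt)
      fun x hx => ?_
    replace hx := interior_subset hx
    rw [(hder x hx).deriv]
    have hx0 : 0 < x := by linarith [hx.1]
    have hA' := hA x hx
    have hB' := hB x hx
    set T := m + e * (r / 2) * (x + x⁻¹) with hT
    have hmδ : 0 < m + δ := by positivity
    have hr' : r = ρ * (m + δ) := by rw [hρ]; field_simp
    -- This is m² = r² + δ² expressed through ρ; it yields the factorisation of T x below.
    have hκ : (m + δ) * (1 - ρ ^ 2) = 2 * δ := by
      rw [hρ]; field_simp; linear_combination h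
    have hTx : T * x = (m + δ) / 2 * ((x + e * ρ) * (1 + e * ρ * x)) := by
      have : T * x = m * x + e * (r / 2) * (x ^ 2 + 1) := by rw [hT]; field_simp
      rw [this, hr']
      linear_combination x * hκ / 2 - (m + δ) / 2 * ρ ^ 2 * x * he
    have hTpos : 0 < T := by
      have : 0 < T * x := hTx ▸ by positivity
      exact pos_of_mul_pos_left this hx0.le
    -- The derivative is a square over T x > 0, and the function vanishes at 1.
    have key : e * (r / 2) * (1 - -(x ^ 2)⁻¹) + δ * (1 / (x + e * ρ) - e * ρ * 1 / (1 + e * ρ * x))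
        - m * x⁻¹ = ((e * (r / 2) * (x - x⁻¹)) ^ 2) / (T * x) := by
      have e1 : 1 / (x + e * ρ) - e * ρ * 1 / (1 + e * ρ * x) = δ / (T * x) := by
        rw [hTx, div_sub_div _ _ hA'.ne' hB'.ne', div_eq_div_iff (by positivity) (by positivity)]
        linear_combination (x + e * ρ) * (1 + e * ρ * x) / 2 * (hκ - (m + δ) * ρ ^ 2 * he)
      rw [e1]
      have e2 : e * (r / 2) * (1 - -(x ^ 2)⁻¹) = (T - m) / x := by rw [hT]; field_simp; ring
      rw [e2]
      have e3 : (e * (r / 2) * (x - x⁻¹)) ^ 2 = (T - m) ^ 2 - r ^ 2 := by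
        rw [hT]; field_simp; linear_combination (-r ^ 2 * 4 * x ^ 2) * he
      rw [e3]
      field_simp
      linear_combination -h
    rw [key]
    positivity
  have := hmono ⟨le_rfl, hy⟩ ⟨hy, le_rfl⟩ hy
  refine le_trans (le_of_eq ?_) this
  simp [add_comm]

/-- This is `excess_nonneg` with z = e y in the closed form. As ρ ≤ 1 ≤ y and T > 0, both factors of
T y are positive, so log T splits accordingly. -/
lemma lagrangeConst_le_of_eq (hm : 0 < m) (hr : 0 < r) (hδ : 0 ≤ δ) (h : m ^ 2 = r ^ 2 + δ ^ 2)
    {e y T : ℝ} (he : e ^ 2 = 1) (hy : 1 ≤ y) (hT : T = m + e * (r / 2) * (y + y⁻¹))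
    (hT0 : 0 < T) :
    lagrangeConst m r δ ≤ T - δ * Real.log T - squarePotential m r δ T := by
  have hy0 : 0 < y := by linarith
  have he' : e = 1 ∨ e = -1 := mul_self_eq_one_iff.1 (by rw [← sq, he])
  have habs : |e| = 1 := by rcases he' with rfl | rfl <;> simp
  have hinv : e⁻¹ = e := by rcases he' with rfl | rfl <;> norm_num
  have hmδ : 0 < m + δ := by positivity
  set ρ := r / (m + δ) with hρ
  have hρ0 : 0 < ρ := by positivity
  have hρ1 : ρ ≤ 1 := (div_le_one hmδ).2 (by linarith [le_of_sq_eq hm h])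
  have hr' : r = ρ * (m + δ) := by rw [hρ]; field_simp
  have hκ : (m + δ) * (1 - ρ ^ 2) = 2 * δ := by
    rw [hρ]; field_simp; linear_combination h
  have hTx : T * y = (m + δ) / 2 * ((y + e * ρ) * (1 + e * ρ * y)) := by
    have : T * y = m * y + e * (r / 2) * (y ^ 2 + 1) := by rw [hT]; field_simp
    rw [this, hr']
    linear_combination y * hκ / 2 - (m + δ) / 2 * ρ ^ 2 * y * he
  have hA0 : 0 ≤ y + e * ρ := by
    rcases he' with rfl | rfl <;> linarith
  have hAB : 0 < (y + e * ρ) * (1 + e * ρ * y) := by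
    have : 0 < T * y := by positivity
    rw [hTx] at this
    exact pos_of_mul_pos_right this (by positivity)
  have hA : 0 < y + e * ρ := lt_of_le_of_ne hA0 fun h0 => by rw [← h0] at hAB; simp at hAB
  have hB : 0 < 1 + e * ρ * y := pos_of_mul_pos_right hAB hA0
  have hex := excess_nonneg hm hr hδ h he hy hB
  rw [← hρ] at hex
  have hzn : ‖((e * y : ℝ) : ℂ)‖ = y := by
    rw [Complex.norm_real, Real.norm_eq_abs, abs_mul, habs, one_mul, abs_of_pos hy0]
  have hTz : (T : ℂ) = m + r / 2 * (((e * y : ℝ) : ℂ) + ((e * y : ℝ) : ℂ)⁻¹) := by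
    rw [hT, ← Complex.ofReal_inv, mul_inv, hinv]
    push_cast
    ring
  rw [squarePotential_eq hm hr hδ h (by rw [hzn]; exact hy) hTz, hzn, ← Complex.ofReal_inv,
    Complex.ofReal_re, mul_inv, hinv, ← hρ]
  have e1 : ‖1 + (ρ : ℂ) * ((e * y⁻¹ : ℝ) : ℂ)‖ = (y + e * ρ) / y := by
    rw [show (1 : ℂ) + (ρ : ℂ) * ((e * y⁻¹ : ℝ) : ℂ) = (((y + e * ρ) / y : ℝ) : ℂ) by
      have : (y : ℂ) ≠ 0 := Complex.ofReal_ne_zero.2 hy0.ne'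
      push_cast; field_simp, Complex.norm_real, Real.norm_eq_abs, abs_of_pos (by positivity)]
  have e2 : Real.log T = Real.log ((m + δ) / 2) + Real.log (y + e * ρ) + Real.log (1 + e * ρ * y)
      - Real.log y := by
    rw [eq_sub_iff_add_eq, ← Real.log_mul hT0.ne' hy0.ne', hTx, Real.log_mul (by positivity)
      (by positivity), Real.log_mul hA.ne' hB.ne', add_assoc]
  rw [e1, Real.log_div hA.ne' hy0.ne', e2, lagrangeConst]
  have e3 : T = m + e * (r / 2) * (y - y⁻¹) + r * (e * y⁻¹) := by rw [hT]; ring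
  rw [e3]
  nlinarith [hex]

/-- Points off the support are m ± (r/2)(y + 1/y) with y ≥ 1. For δ > 0 the point T = 0 is excluded,
since `Real.log 0 = 0` misrepresents the infinite potential there. -/
lemma lagrangeConst_le (hm : 0 < m) (hr : 0 < r) (hδ : 0 ≤ δ) (h : m ^ 2 = r ^ 2 + δ ^ 2)
    {T : ℝ} (hT : 0 ≤ T) (hT0 : 0 < δ → T ≠ 0) :
    lagrangeConst m r δ ≤ T - δ * Real.log T - squarePotential m r δ T := by
  by_cases hmem : T ∈ Set.Icc (m - r) (m + r)
  · exact (sub_squarePotential_eq_of_mem hm hr hδ h hmem).ge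
  have hTpos : 0 < T := by
    refine lt_of_le_of_ne hT fun h0 => ?_
    -- For δ = 0 one has m = r, so T = 0 already belongs to the support interval.
    rcases hδ.eq_or_lt with rfl | hδ
    · refine hmem ⟨?_, by linarith⟩
      have : m ≤ r := abs_le_of_sq_le_sq' (by nlinarith) hr.le |>.2
      linarith
    · exact hT0 hδ h0.symm
  rcases lt_or_ge (m + r) T with h1 | h1
  · obtain ⟨y, hy, hyu⟩ := exists_add_inv_eq (u := (T - m) / r)
      ((one_le_div hr).2 (by linarith))
    refine lagrangeConst_le_of_eq hm hr hδ h (e := 1) (by norm_num) hy ?_ hTpos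
    rw [hyu]; field_simp; ring
  · have h2 : T < m - r := by
      by_contra h3
      exact hmem ⟨not_lt.1 h3, h1⟩
    obtain ⟨y, hy, hyu⟩ := exists_add_inv_eq (u := (m - T) / r)
      ((one_le_div hr).2 (by linarith))
    refine lagrangeConst_le_of_eq hm hr hδ h (e := -1) (by norm_num) hy ?_ hTpos
    rw [hyu]; field_simp; ring

end EulerLagrange

/-! ### Conditional positive definiteness of the logarithmic kernel -/

section PositiveDefinite

/-- Subtraction is truncated in [0, ∞], so the square of the difference is replaced by c² with b = a
+ c. -/
lemma two_mul_mul_le_add (a b : ℝ≥0∞) : 2 * (a * b) ≤ a * a + b * b := by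
  wlog h : a ≤ b generalizing a b
  · rw [mul_comm a b, add_comm]
    exact this b a (le_of_not_ge h)
  obtain ⟨c, rfl⟩ := exists_add_of_le h
  calc 2 * (a * (a + c)) ≤ 2 * (a * (a + c)) + c * c := le_self_add
    _ = a * a + (a + c) * (a + c) := by ring

/-- A kernel of the form `∫ φ(p, s) φ(p, t) dΛ(p)` is positive definite. -/
lemma two_mul_lintegral_kernel_le {P X : Type*} [MeasurableSpace P] [MeasurableSpace X]
    (Λ : Measure P) [SFinite Λ] (μ ν : Measure X) [SFinite μ] [SFinite ν]
    {φ : P × X → ℝ≥0∞} (hφ : Measurable φ) :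
    2 * ∫⁻ x, ∫⁻ p, φ (p, x.1) * φ (p, x.2) ∂Λ ∂(μ.prod ν)
      ≤ ∫⁻ x, ∫⁻ p, φ (p, x.1) * φ (p, x.2) ∂Λ ∂(μ.prod μ)
        + ∫⁻ x, ∫⁻ p, φ (p, x.1) * φ (p, x.2) ∂Λ ∂(ν.prod ν) := by
  have key : ∀ (α γ : Measure X) [SFinite α] [SFinite γ],
      ∫⁻ x, ∫⁻ p, φ (p, x.1) * φ (p, x.2) ∂Λ ∂(α.prod γ)
        = ∫⁻ p, (∫⁻ s, φ (p, s) ∂α) * ∫⁻ t, φ (p, t) ∂γ ∂Λ := fun α γ _ _ => by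
    rw [lintegral_lintegral_swap (by fun_prop)]
    refine lintegral_congr fun p => ?_
    exact lintegral_prod_mul (f := fun s => φ (p, s)) (g := fun t => φ (p, t))
      (by fun_prop) (by fun_prop)
  have hm : ∀ (α : Measure X) [SFinite α], Measurable fun p => ∫⁻ s, φ (p, s) ∂α :=
    fun α _ => hφ.lintegral_prod_right'
  have h1 : Measurable fun p => (∫⁻ s, φ (p, s) ∂μ) * ∫⁻ s, φ (p, s) ∂ν := (hm μ).mul (hm ν)
  have h2 : Measurable fun p => (∫⁻ s, φ (p, s) ∂μ) * ∫⁻ s, φ (p, s) ∂μ := (hm μ).mul (hm μ)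
  rw [key, key, key, ← lintegral_const_mul _ h1, ← lintegral_add_left h2]
  refine lintegral_mono fun p => ?_
  simp only
  generalize ∫⁻ s, φ (p, s) ∂μ = a
  generalize ∫⁻ s, φ (p, s) ∂ν = b
  exact two_mul_mul_le_add a b

/-- The overlap kernel: the intervals of radius `r < R` around `s` and `t`, averaged over the
scales `r`. -/
noncomputable def overlapKernel (R s t : ℝ) : ℝ≥0∞ :=
  ∫⁻ p : ℝ × ℝ, ({p : (ℝ × ℝ) × ℝ | |p.2 - p.1.2| < p.1.1}.indicator 1 (p, s) : ℝ≥0∞) *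
    {p : (ℝ × ℝ) × ℝ | |p.2 - p.1.2| < p.1.1}.indicator 1 (p, t)
    ∂(((volume.restrict (Set.Ioc 0 R)).withDensity fun r => ENNReal.ofReal (1 / (2 * r ^ 2))).prod
      volume)

lemma measurableSet_abs_sub_lt :
    MeasurableSet {p : (ℝ × ℝ) × ℝ | |p.2 - p.1.2| < p.1.1} :=
  measurableSet_lt (by fun_prop) (by fun_prop)

lemma overlapKernel_eq_lintegral (R s t : ℝ) :
    overlapKernel R s t = ∫⁻ r in Set.Ioc 0 R,
      ENNReal.ofReal (1 / (2 * r ^ 2)) * ENNReal.ofReal (2 * r - |s - t|) := by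
  have hφ : Measurable ({p : (ℝ × ℝ) × ℝ | |p.2 - p.1.2| < p.1.1}.indicator
    (1 : (ℝ × ℝ) × ℝ → ℝ≥0∞)) := measurable_one.indicator measurableSet_abs_sub_lt
  rw [overlapKernel, lintegral_prod _ (by fun_prop), lintegral_withDensity_eq_lintegral_mul _
    (by fun_prop)]
  · refine lintegral_congr fun r => ?_
    simp only [Pi.mul_apply]
    congr 1
    have : ∀ w : ℝ, ({p : (ℝ × ℝ) × ℝ | |p.2 - p.1.2| < p.1.1}.indicator 1 ((r, w), s) : ℝ≥0∞) *
        {p : (ℝ × ℝ) × ℝ | |p.2 - p.1.2| < p.1.1}.indicator 1 ((r, w), t)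
        = (Metric.ball s r ∩ Metric.ball t r).indicator 1 w := fun w => by
      rw [Set.inter_indicator_one]
      simp only [Pi.mul_apply, Set.indicator, Metric.mem_ball, Real.dist_eq, Set.mem_ofPred_eq,
        abs_sub_comm w]
      rfl
    simp only [this]
    rw [lintegral_indicator_one (measurableSet_ball.inter measurableSet_ball),
      Real.ball_eq_Ioo, Real.ball_eq_Ioo, Set.Ioo_inter_Ioo, Real.volume_Ioo]
    congr 1
    rcases le_total s t with hst | hst
    · rw [abs_of_nonpos (by linarith), inf_eq_left.2 (by linarith), sup_eq_right.2 (by linarith)]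
      ring
    · rw [abs_of_nonneg (by linarith), inf_eq_right.2 (by linarith), sup_eq_left.2 (by linarith)]
      ring
  · exact Measurable.lintegral_prod_right' (f := fun p : ℝ × ℝ =>
      ({p : (ℝ × ℝ) × ℝ | |p.2 - p.1.2| < p.1.1}.indicator 1 (p, s) : ℝ≥0∞) *
      {p : (ℝ × ℝ) × ℝ | |p.2 - p.1.2| < p.1.1}.indicator 1 (p, t)) (by fun_prop)

/-- Intervals of radius r at distance x meet only for r > x/2; there the integrand 1/r − x/(2r²) has
primitive log r + x/(2r). -/
lemma setLIntegral_overlap {R x : ℝ} (hx : 0 < x) (hxR : x ≤ 2 * R) :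
    ∫⁻ r in Set.Ioc 0 R, ENNReal.ofReal (1 / (2 * r ^ 2)) * ENNReal.ofReal (2 * r - x)
      = ENNReal.ofReal (-Real.log x + (Real.log (2 * R) - 1) + x / (2 * R)) := by
  have hR : 0 < R := by linarith
  have hle : x / 2 ≤ R := by linarith
  have h1 : ∫⁻ r in Set.Ioc 0 R, ENNReal.ofReal (1 / (2 * r ^ 2)) * ENNReal.ofReal (2 * r - x)
      = ∫⁻ r in Set.Ioc (x / 2) R, ENNReal.ofReal (1 / (2 * r ^ 2) * (2 * r - x)) := by
    rw [← lintegral_indicator measurableSet_Ioc, ← lintegral_indicator measurableSet_Ioc]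
    refine lintegral_congr fun r => ?_
    by_cases hr : r ∈ Set.Ioc (x / 2) R
    · have h0 : r ∈ Set.Ioc 0 R := ⟨by linarith [hr.1], hr.2⟩
      rw [Set.indicator_of_mem hr, Set.indicator_of_mem h0, ENNReal.ofReal_mul (by positivity)]
    · rw [Set.indicator_of_notMem hr]
      by_cases h0 : r ∈ Set.Ioc 0 R
      · rw [Set.indicator_of_mem h0, ENNReal.ofReal_of_nonpos (p := 2 * r - x), mul_zero]
        by_contra h3
        exact hr ⟨by linarith, h0.2⟩
      · rw [Set.indicator_of_notMem h0]
  have hpos : ∀ r ∈ Set.uIcc (x / 2) R, 0 < r := fun r hr => by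
    rw [Set.uIcc_of_le hle] at hr; linarith [hr.1]
  have hcont : ContinuousOn (fun r : ℝ => 1 / (2 * r ^ 2) * (2 * r - x)) (Set.uIcc (x / 2) R) := by
    refine ContinuousOn.mul (continuousOn_const.div (by fun_prop) fun r hr => ?_) (by fun_prop)
    have := hpos r hr
    positivity
  have hint := hcont.intervalIntegrable (μ := volume)
  rw [h1, ← ofReal_integral_eq_lintegral_ofReal
    ((intervalIntegrable_iff_integrableOn_Ioc_of_le hle).1 hint),
    ← intervalIntegral.integral_of_le hle,
    intervalIntegral.integral_eq_sub_of_hasDerivAt (f := fun r => Real.log r + x / 2 * r⁻¹)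
      (fun r hr => ?_) hint]
  · congr 1
    rw [Real.log_div hx.ne' two_ne_zero, Real.log_mul two_ne_zero hR.ne']
    field_simp
    ring
  · have := hpos r hr
    have := (Real.hasDerivAt_log (hpos r hr).ne').add ((hasDerivAt_inv (hpos r hr).ne').const_mul
      (x / 2))
    refine this.congr_deriv ?_
    field_simp
    ring
  · filter_upwards [ae_restrict_mem measurableSet_Ioc] with r hr
    exact mul_nonneg (by positivity) (by linarith [hr.1])

lemma setLIntegral_overlap_eq_zero {R x : ℝ} (hxR : 2 * R ≤ x) :
    ∫⁻ r in Set.Ioc 0 R, ENNReal.ofReal (1 / (2 * r ^ 2)) * ENNReal.ofReal (2 * r - x) = 0 := by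
  rw [← lintegral_zero (μ := volume.restrict (Set.Ioc 0 R))]
  refine setLIntegral_congr_fun measurableSet_Ioc fun r hr => ?_
  rw [ENNReal.ofReal_of_nonpos (p := 2 * r - x) (by linarith [hr.2]), mul_zero]

/-- Within range the term |s − t|/(2R) is dropped; beyond 2R the left side is truncated to 0. -/
lemma le_overlapKernel {R s t : ℝ} (hR : 0 < R) (hst : s ≠ t) :
    ENNReal.ofReal (-Real.log |s - t| + (Real.log (2 * R) - 1)) ≤ overlapKernel R s t := by
  have hx : 0 < |s - t| := abs_pos.2 (sub_ne_zero.2 hst)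
  rw [overlapKernel_eq_lintegral]
  rcases le_total |s - t| (2 * R) with h | h
  · rw [setLIntegral_overlap hx h]
    exact ENNReal.ofReal_le_ofReal (le_add_of_nonneg_right (by positivity))
  · rw [ENNReal.ofReal_of_nonpos]
    · exact zero_le
    · have := Real.log_le_log (by positivity) h
      linarith

lemma sub_log_nonneg {R x : ℝ} (hR : 0 < R) (hx : 0 < x) :
    0 ≤ -Real.log x + (Real.log (2 * R) - 1) + x / (2 * R) := by
  have := Real.log_le_sub_one_of_pos (x := x / (2 * R)) (by positivity)
  rw [Real.log_div hx.ne' (by positivity)] at this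
  linarith

lemma overlapKernel_le {R s t : ℝ} (hst : s ≠ t) :
    overlapKernel R s t ≤
      ENNReal.ofReal (-Real.log |s - t| + (Real.log (2 * R) - 1) + |s - t| / (2 * R)) := by
  have hx : 0 < |s - t| := abs_pos.2 (sub_ne_zero.2 hst)
  rw [overlapKernel_eq_lintegral]
  rcases le_total |s - t| (2 * R) with h | h
  · rw [setLIntegral_overlap hx h]
  · rw [setLIntegral_overlap_eq_zero h]
    exact zero_le

/-- The logarithmic kernel is conditionally positive definite. -/
theorem two_mul_integral_log_le {μ ν : Measure ℝ} [IsProbabilityMeasure μ] [IsProbabilityMeasure ν]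
    (hμ1 : Integrable (fun x => x) μ) (hν1 : Integrable (fun x => x) ν)
    (hμμ : Integrable (fun p : ℝ × ℝ => Real.log |p.1 - p.2|) (μ.prod μ))
    (hνν : Integrable (fun p : ℝ × ℝ => Real.log |p.1 - p.2|) (ν.prod ν))
    (hμν : Integrable (fun p : ℝ × ℝ => Real.log |p.1 - p.2|) (μ.prod ν))
    (dμ : ∀ᵐ p : ℝ × ℝ ∂μ.prod μ, p.1 ≠ p.2) (dν : ∀ᵐ p : ℝ × ℝ ∂ν.prod ν, p.1 ≠ p.2)
    (dμν : ∀ᵐ p : ℝ × ℝ ∂μ.prod ν, p.1 ≠ p.2) :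
    ∫ p, Real.log |p.1 - p.2| ∂(μ.prod μ) + ∫ p, Real.log |p.1 - p.2| ∂(ν.prod ν)
      ≤ 2 * ∫ p, Real.log |p.1 - p.2| ∂(μ.prod ν) := by
  set M : ℝ := ∫ p, |p.1 - p.2| ∂(μ.prod μ) + ∫ p, |p.1 - p.2| ∂(ν.prod ν) with hM
  have hφ : Measurable ({p : (ℝ × ℝ) × ℝ | |p.2 - p.1.2| < p.1.1}.indicator
    (1 : (ℝ × ℝ) × ℝ → ℝ≥0∞)) := measurable_one.indicator measurableSet_abs_sub_lt
  have upper : ∀ (α : Measure ℝ) [IsProbabilityMeasure α] (R : ℝ), 0 < R →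
      Integrable (fun x => x) α →
      Integrable (fun p : ℝ × ℝ => Real.log |p.1 - p.2|) (α.prod α) →
      (∀ᵐ p : ℝ × ℝ ∂α.prod α, p.1 ≠ p.2) →
      0 ≤ -∫ p, Real.log |p.1 - p.2| ∂(α.prod α) + (Real.log (2 * R) - 1)
        + (∫ p, |p.1 - p.2| ∂(α.prod α)) / (2 * R) ∧
      ∫⁻ p, overlapKernel R p.1 p.2 ∂(α.prod α) ≤
        ENNReal.ofReal (-∫ p, Real.log |p.1 - p.2| ∂(α.prod α) + (Real.log (2 * R) - 1)
          + (∫ p, |p.1 - p.2| ∂(α.prod α)) / (2 * R)) := by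
    intro α _ R hR h1 hl hd
    have habs : Integrable (fun p : ℝ × ℝ => |p.1 - p.2|) (α.prod α) :=
      ((h1.comp_fst α).sub (h1.comp_snd α)).abs
    have hI : Integrable (fun p : ℝ × ℝ => -Real.log |p.1 - p.2| + (Real.log (2 * R) - 1)
        + |p.1 - p.2| / (2 * R)) (α.prod α) :=
      (hl.neg.add (integrable_const _)).add (habs.div_const _)
    have e : -∫ p, Real.log |p.1 - p.2| ∂(α.prod α) + (Real.log (2 * R) - 1)
        + (∫ p, |p.1 - p.2| ∂(α.prod α)) / (2 * R)
        = ∫ p, (-Real.log |p.1 - p.2| + (Real.log (2 * R) - 1)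
        + |p.1 - p.2| / (2 * R)) ∂(α.prod α) := by
      have hl' : Integrable (fun p : ℝ × ℝ => -Real.log |p.1 - p.2|) (α.prod α) := hl.neg
      rw [integral_add (f := fun p : ℝ × ℝ => -Real.log |p.1 - p.2| + (Real.log (2 * R) - 1))
        (hl'.add (integrable_const _)) (habs.div_const _),
        integral_add hl' (integrable_const _), integral_div, integral_neg, integral_const]
      simp
    have hnn : ∀ᵐ p : ℝ × ℝ ∂α.prod α, 0 ≤ -Real.log |p.1 - p.2| + (Real.log (2 * R) - 1)
        + |p.1 - p.2| / (2 * R) := by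
      filter_upwards [hd] with p hp
      exact sub_log_nonneg hR (abs_pos.2 (sub_ne_zero.2 hp))
    rw [e]
    refine ⟨integral_nonneg_of_ae hnn, ?_⟩
    rw [ofReal_integral_eq_lintegral_ofReal hI hnn]
    refine lintegral_mono_ae ?_
    filter_upwards [hd] with p hp using overlapKernel_le hp
  -- All measures have mass 1, so the constants log(2R) − 1 cancel and only M/(2R) remains, which
  -- vanishes as R → ∞.
  have main : ∀ R : ℝ, 0 < R → ∫ p, Real.log |p.1 - p.2| ∂(μ.prod μ)
      + ∫ p, Real.log |p.1 - p.2| ∂(ν.prod ν)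
      ≤ 2 * ∫ p, Real.log |p.1 - p.2| ∂(μ.prod ν) + M / (2 * R) := by
    intro R hR
    obtain ⟨uμ0, uμ⟩ := upper μ R hR hμ1 hμμ dμ
    obtain ⟨uν0, uν⟩ := upper ν R hR hν1 hνν dν
    have low : ENNReal.ofReal (-∫ p, Real.log |p.1 - p.2| ∂(μ.prod ν) + (Real.log (2 * R) - 1))
        ≤ ∫⁻ p, overlapKernel R p.1 p.2 ∂(μ.prod ν) := by
      have hI : Integrable (fun p : ℝ × ℝ => -Real.log |p.1 - p.2| + (Real.log (2 * R) - 1))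
          (μ.prod ν) := hμν.neg.add (integrable_const _)
      have e : -∫ p, Real.log |p.1 - p.2| ∂(μ.prod ν) + (Real.log (2 * R) - 1)
          = ∫ p, (-Real.log |p.1 - p.2| + (Real.log (2 * R) - 1)) ∂(μ.prod ν) := by
        have hl' : Integrable (fun p : ℝ × ℝ => -Real.log |p.1 - p.2|) (μ.prod ν) := hμν.neg
        rw [integral_add hl' (integrable_const _), integral_neg, integral_const]
        simp
      -- The lower bound on the kernel is truncated at 0, so the integrand is first enlarged to its
      -- positive part.
      have h1 : ∫ p, (-Real.log |p.1 - p.2| + (Real.log (2 * R) - 1)) ∂(μ.prod ν)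
          ≤ ∫ p, max (-Real.log |p.1 - p.2| + (Real.log (2 * R) - 1)) 0 ∂(μ.prod ν) :=
        integral_mono hI hI.pos_part fun p => le_max_left _ _
      rw [e]
      refine (ENNReal.ofReal_le_ofReal h1).trans ?_
      rw [ofReal_integral_eq_lintegral_ofReal hI.pos_part
        (Eventually.of_forall fun p => le_max_right _ _)]
      refine lintegral_mono_ae ?_
      filter_upwards [dμν] with p hp
      rw [ENNReal.ofReal_max, ENNReal.ofReal_zero, max_eq_left zero_le]
      exact le_overlapKernel hR hp
    have cross : 2 * ∫⁻ p, overlapKernel R p.1 p.2 ∂(μ.prod ν)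
        ≤ ∫⁻ p, overlapKernel R p.1 p.2 ∂(μ.prod μ) + ∫⁻ p, overlapKernel R p.1 p.2 ∂(ν.prod ν) :=
      two_mul_lintegral_kernel_le _ μ ν hφ
    have all := (mul_le_mul_right low 2).trans (cross.trans (add_le_add uμ uν))
    rw [← ENNReal.ofReal_add uμ0 uν0, ← ENNReal.ofReal_ofNat, ← ENNReal.ofReal_mul (by norm_num),
      ENNReal.ofReal_le_ofReal_iff (add_nonneg uμ0 uν0)] at all
    rw [hM, add_div]
    linarith
  refine ge_of_tendsto (x := atTop) (f := fun R : ℝ =>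
    2 * ∫ p, Real.log |p.1 - p.2| ∂(μ.prod ν) + M / (2 * R)) ?_ ?_
  · have : Tendsto (fun R : ℝ => M / (2 * R)) atTop (𝓝 0) :=
      tendsto_const_nhds.div_atTop (tendsto_id.const_mul_atTop two_pos)
    simpa using this.const_add (2 * ∫ p, Real.log |p.1 - p.2| ∂(μ.prod ν))
  · filter_upwards [eventually_gt_atTop 0] with R hR using main R hR

end PositiveDefinite

/-! ### Extended integrals and integrability -/

section ExtIntegral

variable {X : Type*} [MeasurableSpace X] {m : Measure X} {f : X → EReal} {g h : X → ℝ}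

lemma extIntegral_eq_coe (hg : Integrable g m) (hfg : ∀ᵐ x ∂m, f x = g x) :
    extIntegral m f = ((∫ x, g x ∂m : ℝ) : EReal) := by
  have e1 : ∫⁻ x, (f x).toENNReal ∂m = ∫⁻ x, ENNReal.ofReal (g x) ∂m := by
    refine lintegral_congr_ae ?_
    filter_upwards [hfg] with x hx
    rw [hx, EReal.toENNReal_of_ne_top (EReal.coe_ne_top _), EReal.toReal_coe]
  have e2 : ∫⁻ x, (-f x).toENNReal ∂m = ∫⁻ x, ENNReal.ofReal (-g x) ∂m := by
    refine lintegral_congr_ae ?_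
    filter_upwards [hfg] with x hx
    rw [hx, ← EReal.coe_neg, EReal.toENNReal_of_ne_top (EReal.coe_ne_top _), EReal.toReal_coe]
  have f1 : ∫⁻ x, ENNReal.ofReal (g x) ∂m ≠ ⊤ := hg.lintegral_lt_top.ne
  have f2 : ∫⁻ x, ENNReal.ofReal (-g x) ∂m ≠ ⊤ := hg.neg.lintegral_lt_top.ne
  rw [extIntegral, e1, e2, integral_eq_lintegral_pos_part_sub_lintegral_neg_part hg,
    EReal.coe_sub, EReal.coe_ennreal_toReal f1, EReal.coe_ennreal_toReal f2]

/-- The minorant −h makes the negative part finite. A value other than ⊤ then forces a finite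
positive part, hence f < ⊤ almost everywhere. -/
lemma integrable_of_extIntegral_ne_top (hgm : AEStronglyMeasurable g m)
    (hfm : AEMeasurable (fun x => (f x).toENNReal) m) (hfg : ∀ x, f x = ⊤ ∨ f x = g x)
    (hh : Integrable h m) (hgh : ∀ x, -h x ≤ g x)
    (hne : extIntegral m f ≠ ⊤) : (∀ᵐ x ∂m, f x = g x) ∧ Integrable g m := by
  have hN : ∫⁻ x, (-f x).toENNReal ∂m ≠ ⊤ := by
    refine ne_top_of_le_ne_top hh.lintegral_lt_top.ne (lintegral_mono fun x => ?_)
    rcases hfg x with hx | hx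
    · simp [hx]
    · rw [hx, ← EReal.coe_neg, EReal.toENNReal_of_ne_top (EReal.coe_ne_top _), EReal.toReal_coe]
      exact ENNReal.ofReal_le_ofReal (by linarith [hgh x])
  have hP : ∫⁻ x, (f x).toENNReal ∂m ≠ ⊤ := by
    intro hP
    refine hne ?_
    rw [extIntegral, hP, EReal.coe_ennreal_top, EReal.top_sub]
    simpa using hN
  have hae : ∀ᵐ x ∂m, f x = g x := by
    filter_upwards [ae_lt_top' hfm hP] with x hx
    rcases hfg x with h1 | h1
    · simp [h1] at hx
    · exact h1
  refine ⟨hae, hgm, ?_⟩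
  rw [hasFiniteIntegral_iff_norm]
  have hle : ∫⁻ x, ENNReal.ofReal ‖g x‖ ∂m
      ≤ ∫⁻ x, ((f x).toENNReal + ENNReal.ofReal (h x)) ∂m := by
    refine lintegral_mono_ae ?_
    filter_upwards [hae] with x hx
    rw [hx, EReal.toENNReal_of_ne_top (EReal.coe_ne_top _), EReal.toReal_coe, Real.norm_eq_abs]
    rcases le_total 0 (g x) with h1 | h1
    · rw [abs_of_nonneg h1]; exact le_self_add
    · rw [abs_of_nonpos h1]
      exact (ENNReal.ofReal_le_ofReal (by linarith [hgh x])).trans le_add_self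
  refine hle.trans_lt ?_
  rw [lintegral_add_left' hfm]
  exact ENNReal.add_lt_top.2 ⟨hP.lt_top, hh.lintegral_lt_top⟩

end ExtIntegral

/-! ### Reduction of the energy to real integrals -/

section Energy

variable {β δ : ℝ} {ν : Measure ℝ}

lemma logInv_eq_coe {x : ℝ} (hx : x ≠ 0) : logInv x = ((-Real.log |x| : ℝ) : EReal) := by
  rw [logInv, if_neg hx, one_div, Real.log_inv]

lemma logInv_zero : logInv 0 = ⊤ := if_pos rfl

lemma Q_eq_coe {t : ℝ} (ht : t ≠ 0) :
    Q δ t = ((t ^ 2 - 2 * δ * Real.log |t| : ℝ) : EReal) := by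
  rw [Q, logInv_eq_coe ht, ← EReal.coe_mul, ← EReal.coe_add]
  congr 1
  ring

lemma Q_zero_pot (t : ℝ) : Q 0 t = ((t ^ 2 - 2 * 0 * Real.log |t| : ℝ) : EReal) := by
  simp [Q]

lemma Q_at_zero (hδ : 0 < δ) : Q δ 0 = ⊤ := by
  rw [Q, logInv_zero, EReal.coe_mul_top_of_pos (by positivity), EReal.coe_add_top]

lemma measurable_logInv : Measurable logInv := by
  unfold logInv
  refine Measurable.ite (measurableSet_singleton 0) measurable_const ?_
  exact measurable_coe_real_ereal.comp (by fun_prop)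

lemma measurable_Q : Measurable (Q δ) := by
  have : Q δ = fun t => if t = 0 then Q δ 0 else ((t ^ 2 - 2 * δ * Real.log |t| : ℝ) : EReal) := by
    ext t
    split_ifs with h
    · rw [h]
    · exact Q_eq_coe h
  rw [this]
  refine Measurable.ite (measurableSet_singleton 0) measurable_const ?_
  exact measurable_coe_real_ereal.comp (by fun_prop)

/-- The integrability conditions under which the energy is an honest real number. -/
structure HasFiniteEnergy (δ : ℝ) (ν : Measure ℝ) : Prop where
  integrable_sq : Integrable (fun t => t ^ 2) ν
  -- The factor δ stays inside, so that nothing is asked of log|t| when δ = 0.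
  integrable_log : Integrable (fun t => δ * Real.log |t|) ν
  ae_ne_zero : 0 < δ → ∀ᵐ t ∂ν, t ≠ 0
  integrable_log_sub : Integrable (fun p : ℝ × ℝ => Real.log |p.1 - p.2|) (ν.prod ν)
  ae_ne : ∀ᵐ p : ℝ × ℝ ∂ν.prod ν, p.1 ≠ p.2

/-- The energy of a measure satisfying `HasFiniteEnergy`. -/
noncomputable def realEnergy (β δ : ℝ) (ν : Measure ℝ) : ℝ :=
  -(β / 2 * ∫ p, Real.log |p.1 - p.2| ∂(ν.prod ν))
    + (∫ t, t ^ 2 ∂ν - 2 * ∫ t, δ * Real.log |t| ∂ν)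

lemma HasFiniteEnergy.integrable_id [IsFiniteMeasure ν] (h : HasFiniteEnergy δ ν) :
    Integrable (fun t => t) ν := by
  refine Integrable.mono' (h.integrable_sq.add (integrable_const 1))
    measurable_id.aestronglyMeasurable (Eventually.of_forall fun t => ?_)
  simp only [Real.norm_eq_abs, Pi.add_apply]
  nlinarith [sq_nonneg (|t| - 1), sq_abs t]

lemma energy_eq_coe (hδ : 0 ≤ δ) (h : HasFiniteEnergy δ ν) :
    energy β δ ν = ((realEnergy β δ ν : ℝ) : EReal) := by
  have hQ : extIntegral ν (Q δ)
      = ((∫ t, t ^ 2 ∂ν - 2 * ∫ t, δ * Real.log |t| ∂ν : ℝ) : EReal) := by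
    have hi : Integrable (fun t => t ^ 2 - 2 * (δ * Real.log |t|)) ν :=
      h.integrable_sq.sub (h.integrable_log.const_mul 2)
    rw [extIntegral_eq_coe hi, integral_sub h.integrable_sq (h.integrable_log.const_mul 2),
      integral_const_mul]
    rcases hδ.eq_or_lt with rfl | hδ
    · refine Eventually.of_forall fun t => ?_
      rw [Q_zero_pot]; ring_nf
    · filter_upwards [h.ae_ne_zero hδ] with t ht
      rw [Q_eq_coe ht]; ring_nf
  have hL : extIntegral (ν.prod ν) (fun p : ℝ × ℝ => logInv (p.1 - p.2))
      = ((-∫ p, Real.log |p.1 - p.2| ∂(ν.prod ν) : ℝ) : EReal) := by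
    rw [← integral_neg]
    refine extIntegral_eq_coe h.integrable_log_sub.neg ?_
    filter_upwards [h.ae_ne] with p hp
    exact logInv_eq_coe (sub_ne_zero.2 hp)
  rw [energy, if_neg (by rw [hQ]; exact EReal.coe_ne_top _), hQ, hL, ← EReal.coe_mul,
    ← EReal.coe_add, realEnergy, mul_neg]

lemma log_abs_le (x : ℝ) : Real.log |x| ≤ |x| := by
  rcases eq_or_ne x 0 with rfl | hx
  · simp
  · linarith [Real.log_le_sub_one_of_pos (abs_pos.2 hx)]

/-- Finite ∫ Q_δ controls the second moment; first moments then bound −log|s − t| below by −|s| −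
|t|, so the double integral cannot hide cancellation of infinities. -/
lemma hasFiniteEnergy_of_energy_ne_top (hβ : 0 < β) (hδ : 0 ≤ δ) [IsProbabilityMeasure ν]
    (h : energy β δ ν ≠ ⊤) : HasFiniteEnergy δ ν := by
  have hQ : extIntegral ν (Q δ) ≠ ⊤ := fun hQ => h (if_pos hQ)
  -- From log|t| ≤ |t| and (|t| − 2δ)² ≥ 0.
  have hlow : ∀ t : ℝ, t ^ 2 / 2 - 2 * δ ^ 2 ≤ t ^ 2 - 2 * δ * Real.log |t| := fun t => by
    have := mul_le_mul_of_nonneg_left (log_abs_le t) (by positivity : 0 ≤ 2 * δ)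
    nlinarith [sq_nonneg (|t| - 2 * δ), sq_abs t]
  obtain ⟨ae, hint⟩ := integrable_of_extIntegral_ne_top (m := ν) (f := Q δ)
    (g := fun t => t ^ 2 - 2 * δ * Real.log |t|) (h := fun _ => 2 * δ ^ 2)
    (by fun_prop) (measurable_Q.ereal_toENNReal.aemeasurable)
    (fun t => by
      rcases eq_or_ne t 0 with rfl | ht
      · rcases hδ.eq_or_lt with rfl | hδ
        · exact Or.inr (Q_zero_pot 0)
        · exact Or.inl (Q_at_zero hδ)
      · exact Or.inr (Q_eq_coe ht))
    (integrable_const _)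
    (fun t => by nlinarith [hlow t, sq_nonneg t]) hQ
  have hsq : Integrable (fun t => t ^ 2) ν := by
    refine Integrable.mono' ((hint.const_mul 2).add (integrable_const (4 * δ ^ 2)))
      (by fun_prop) (Eventually.of_forall fun t => ?_)
    simp only [Real.norm_eq_abs, abs_sq, Pi.add_apply]
    linarith [hlow t]
  have hlog : Integrable (fun t => δ * Real.log |t|) ν := by
    refine ((hsq.sub hint).div_const 2).congr (Eventually.of_forall fun t => ?_)
    simp only [Pi.sub_apply]
    ring
  have hid : Integrable (fun t => |t|) ν := by
    refine Integrable.mono' (hsq.add (integrable_const 1))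
      (by fun_prop) (Eventually.of_forall fun t => ?_)
    simp only [Real.norm_eq_abs, abs_abs, Pi.add_apply]
    nlinarith [sq_nonneg (|t| - 1), sq_abs t]
  have hL : extIntegral (ν.prod ν) (fun p : ℝ × ℝ => logInv (p.1 - p.2)) ≠ ⊤ := by
    intro hL
    refine h ?_
    have hQr : extIntegral ν (Q δ) = ((∫ t, (t ^ 2 - 2 * δ * Real.log |t|) ∂ν : ℝ) : EReal) :=
      extIntegral_eq_coe hint ae
    rw [energy, if_neg hQ, hL, EReal.coe_mul_top_of_pos (by positivity), hQr, EReal.top_add_coe]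
  obtain ⟨ae2, hint2⟩ := integrable_of_extIntegral_ne_top (m := ν.prod ν)
    (f := fun p : ℝ × ℝ => logInv (p.1 - p.2))
    (g := fun p : ℝ × ℝ => -Real.log |p.1 - p.2|) (h := fun p : ℝ × ℝ => |p.1| + |p.2|)
    (Measurable.aestronglyMeasurable (by fun_prop))
    ((measurable_logInv.comp (by fun_prop : Measurable fun p : ℝ × ℝ =>
      p.1 - p.2)).ereal_toENNReal.aemeasurable)
    (fun p => by
      rcases eq_or_ne (p.1 - p.2) 0 with hp | hp
      · exact Or.inl (by rw [hp, logInv_zero])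
      · exact Or.inr (logInv_eq_coe hp))
    ((hid.comp_fst ν).add (hid.comp_snd ν))
    (fun p => neg_le_neg ((log_abs_le _).trans (abs_sub _ _))) hL
  refine ⟨hsq, hlog, fun hδ => ?_, by simpa using hint2.neg, ?_⟩
  · filter_upwards [ae] with t ht h0
    rw [h0, Q_at_zero hδ] at ht
    exact EReal.coe_ne_top _ ht.symm
  · filter_upwards [ae2] with p hp h0
    rw [h0, sub_self, logInv_zero] at hp
    exact EReal.coe_ne_top _ hp.symm

end Energy

/-! ### The density and its image on the circle -/

section Density

variable {β δ : ℝ}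

/-- The midpoint `(a² + b²) / 2`. -/
noncomputable def mid (β δ : ℝ) : ℝ := β / 2 + δ

/-- The radius `(b² - a²) / 2`. -/
noncomputable def rad (β δ : ℝ) : ℝ := β / 2 * √(1 + 4 * δ / β)

lemma mid_pos (hβ : 0 < β) (hδ : 0 ≤ δ) : 0 < mid β δ := by unfold mid; positivity

lemma rad_pos (hβ : 0 < β) (hδ : 0 ≤ δ) : 0 < rad β δ := by unfold rad; positivity

/-- This is a²b² = δ², the relation on which the circle computations rest. -/
lemma mid_sq (hβ : 0 < β) (hδ : 0 ≤ δ) : mid β δ ^ 2 = rad β δ ^ 2 + δ ^ 2 := by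
  rw [mid, rad, mul_pow, Real.sq_sqrt (by positivity)]
  field_simp
  ring

lemma rad_le_mid (hβ : 0 < β) (hδ : 0 ≤ δ) : rad β δ ≤ mid β δ :=
  le_of_sq_eq (mid_pos hβ hδ) (mid_sq hβ hδ)

lemma endA_sq (hβ : 0 < β) (hδ : 0 ≤ δ) : endA β δ ^ 2 = mid β δ - rad β δ := by
  have h1 : β / 2 * (1 + 2 * δ / β - √(1 + 4 * δ / β)) = mid β δ - rad β δ := by
    rw [mid, rad]; field_simp
  have h2 : 0 ≤ 1 + 2 * δ / β - √(1 + 4 * δ / β) := by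
    refine nonneg_of_mul_nonneg_right (a := β / 2) ?_ (by positivity)
    rw [h1]
    exact sub_nonneg.2 (rad_le_mid hβ hδ)
  rw [endA, mul_pow, Real.sq_sqrt (by positivity), Real.sq_sqrt h2, h1]

lemma endB_sq (hβ : 0 < β) (hδ : 0 ≤ δ) : endB β δ ^ 2 = mid β δ + rad β δ := by
  rw [endB, mul_pow, Real.sq_sqrt (by positivity), Real.sq_sqrt (by positivity), mid, rad]
  field_simp

lemma endA_nonneg : 0 ≤ endA β δ := by unfold endA; positivity

lemma endB_nonneg : 0 ≤ endB β δ := by unfold endB; positivity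

lemma endA_lt_endB (hβ : 0 < β) (hδ : 0 ≤ δ) : endA β δ < endB β δ := by
  refine lt_of_pow_lt_pow_left₀ 2 endB_nonneg ?_
  rw [endA_sq hβ hδ, endB_sq hβ hδ]
  linarith [rad_pos hβ hδ]

lemma mem_supportSet_iff {t : ℝ} :
    t ∈ supportSet β δ ↔ endA β δ ≤ |t| ∧ |t| ≤ endB β δ := by
  have hA : 0 ≤ endA β δ := endA_nonneg
  rw [supportSet, Set.mem_union, Set.mem_Icc, Set.mem_Icc]
  rcases le_total 0 t with ht | ht
  · rw [abs_of_nonneg ht]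
    constructor
    · rintro (h | h)
      · exact ⟨by linarith, by linarith⟩
      · exact h
    · exact Or.inr
  · rw [abs_of_nonpos ht]
    constructor
    · rintro (h | h)
      · exact ⟨by linarith, by linarith⟩
      · exact ⟨by linarith, by linarith⟩
    · exact fun h => Or.inl ⟨by linarith, by linarith⟩

/-- Off the support the radicand is nonpositive and `√` returns 0, so the indicator is redundant.
This form shows measurability and continuity in the parameter. -/
lemma density_eq (hβ : 0 < β) (hδ : 0 ≤ δ) (t : ℝ) :
    density β δ t = 2 / (Real.pi * β) * (1 / |t|) *
      √((t ^ 2 - endA β δ ^ 2) * (endB β δ ^ 2 - t ^ 2)) := by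
  by_cases h : t ∈ supportSet β δ
  · rw [density, Set.indicator_of_mem h]
  · rw [density, Set.indicator_of_notMem h, Real.sqrt_eq_zero_of_nonpos, mul_zero]
    rw [mem_supportSet_iff, not_and_or, not_le, not_le] at h
    have hA : 0 ≤ endA β δ := endA_nonneg
    have hAB := endA_lt_endB hβ hδ
    have h0 := abs_nonneg t
    rw [← sq_abs t]
    rcases h with h | h
    · exact mul_nonpos_of_nonpos_of_nonneg (by nlinarith) (by nlinarith)
    · exact mul_nonpos_of_nonneg_of_nonpos (by nlinarith) (by nlinarith)

lemma density_nonneg (hβ : 0 < β) (t : ℝ) : 0 ≤ density β δ t := by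
  refine Set.indicator_nonneg (fun t _ => ?_) t
  positivity

lemma density_abs (hβ : 0 < β) (hδ : 0 ≤ δ) (t : ℝ) : density β δ |t| = density β δ t := by
  rw [density_eq hβ hδ, density_eq hβ hδ, abs_abs, sq_abs]

lemma density_neg (hβ : 0 < β) (hδ : 0 ≤ δ) (t : ℝ) : density β δ (-t) = density β δ t := by
  rw [← density_abs hβ hδ, abs_neg, density_abs hβ hδ]

lemma measurable_density (hβ : 0 < β) (hδ : 0 ≤ δ) : Measurable (density β δ) := by
  rw [funext (density_eq hβ hδ)]
  fun_prop

lemma density_eq_zero {t : ℝ} (ht : endB β δ < |t|) : density β δ t = 0 :=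
  Set.indicator_of_notMem (fun h => (mem_supportSet_iff.1 h).2.not_gt ht) _

/-- On the support the radicand is at most t² b², which absorbs the factor 1/|t| uniformly, even as
a → 0. -/
lemma density_le (hβ : 0 < β) (t : ℝ) :
    density β δ t ≤ 2 / (Real.pi * β) * endB β δ := by
  have hB : 0 ≤ endB β δ := endB_nonneg
  by_cases h : t ∈ supportSet β δ
  · rw [density, Set.indicator_of_mem h, mul_assoc]
    rw [mem_supportSet_iff] at h
    refine mul_le_mul_of_nonneg_left ?_ (by positivity)
    rcases eq_or_ne t 0 with rfl | ht
    · simpa using hB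
    have ht' := abs_pos.2 ht
    rw [one_div, inv_mul_le_iff₀ ht']
    refine Real.sqrt_le_iff.2 ⟨by positivity, ?_⟩
    have h1 : 0 ≤ |t| ^ 2 - endA β δ ^ 2 := by nlinarith [h.1, endA_nonneg (β := β) (δ := δ)]
    rw [← sq_abs t, mul_pow]
    nlinarith [sq_nonneg (endA β δ), sq_nonneg (|t|), sq_nonneg (endB β δ)]
  · rw [density, Set.indicator_of_notMem h]
    positivity

lemma density_le_indicator (hβ : 0 < β) {B : ℝ} (hB : endB β δ ≤ B) (t : ℝ) :
    density β δ t ≤ (Set.Icc (-B) B).indicator (fun _ => 2 / (Real.pi * β) * B) t := by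
  by_cases h : t ∈ Set.Icc (-B) B
  · rw [Set.indicator_of_mem h]
    exact (density_le hβ t).trans (mul_le_mul_of_nonneg_left hB (by positivity))
  · rw [Set.indicator_of_notMem h, density_eq_zero]
    rw [Set.mem_Icc, ← abs_le, not_le] at h
    linarith

lemma integrable_indicator_Icc_const (B c : ℝ) :
    Integrable ((Set.Icc (-B) B).indicator fun _ => c) :=
  (integrable_indicator_iff measurableSet_Icc).2
    (integrableOn_const (by simp))

lemma integrable_density (hβ : 0 < β) (hδ : 0 ≤ δ) : Integrable (density β δ) :=
  (integrable_indicator_Icc_const _ _).mono' (measurable_density hβ hδ).aestronglyMeasurable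
    (Eventually.of_forall fun t => by
      rw [Real.norm_eq_abs, abs_of_nonneg (density_nonneg hβ t)]
      exact density_le_indicator hβ le_rfl t)

lemma integral_nu (hβ : 0 < β) (hδ : 0 ≤ δ) (f : ℝ → ℝ) :
    ∫ t, f t ∂(nu β δ) = ∫ t, density β δ t * f t := by
  rw [nu, integral_withDensity_eq_integral_toReal_smul
    (measurable_density hβ hδ).ennreal_ofReal (Eventually.of_forall fun t => ENNReal.ofReal_lt_top)]
  refine integral_congr_ae (Eventually.of_forall fun t => ?_)
  simp only [ENNReal.toReal_ofReal (density_nonneg hβ t), smul_eq_mul]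

lemma integrable_nu_iff (hβ : 0 < β) (hδ : 0 ≤ δ) (f : ℝ → ℝ) :
    Integrable f (nu β δ) ↔ Integrable fun t => density β δ t * f t := by
  rw [nu, integrable_withDensity_iff_integrable_smul' (measurable_density hβ hδ).ennreal_ofReal
    (Eventually.of_forall fun t => ENNReal.ofReal_lt_top)]
  refine integrable_congr (Eventually.of_forall fun t => ?_)
  simp only [ENNReal.toReal_ofReal (density_nonneg hβ t), smul_eq_mul]

lemma integral_two_pi_comp_cos (F : ℝ → ℝ) :
    ∫ θ in (0 : ℝ)..2 * Real.pi, F (Real.cos θ) = 2 * ∫ θ in (0 : ℝ)..Real.pi, F (Real.cos θ) := by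
  by_cases hF : IntervalIntegrable (fun θ => F (Real.cos θ)) volume 0 Real.pi
  -- No integrability is assumed: otherwise both integrals take the default value 0.
  swap
  · rw [intervalIntegral.integral_undef hF, intervalIntegral.integral_undef, mul_zero]
    refine fun h => hF (h.mono_set ?_)
    rw [Set.uIcc_of_le Real.pi_nonneg, Set.uIcc_of_le (by positivity)]
    exact Set.Icc_subset_Icc le_rfl (by linarith [Real.pi_nonneg])
  have h1 : ∫ θ in Real.pi..2 * Real.pi, F (Real.cos θ)
      = ∫ θ in (0 : ℝ)..Real.pi, F (Real.cos θ) := by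
    have := intervalIntegral.integral_comp_sub_left (fun θ => F (Real.cos θ)) (2 * Real.pi)
      (a := 0) (b := Real.pi)
    simp only [Real.cos_two_pi_sub, sub_zero] at this
    rw [this]
    ring_nf
  have h2 : IntervalIntegrable (fun θ => F (Real.cos θ)) volume Real.pi (2 * Real.pi) := by
    have := hF.comp_sub_left (2 * Real.pi)
    simp only [Real.cos_two_pi_sub, sub_zero] at this
    have h := this.symm
    ring_nf at h ⊢
    exact h
  rw [← intervalIntegral.integral_add_adjacent_intervals hF h2, h1, two_mul]

lemma image_sqrt_cos (hβ : 0 < β) (hδ : 0 ≤ δ) :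
    (fun θ => √(mid β δ + rad β δ * Real.cos θ)) '' Set.Ioo 0 Real.pi
      = Set.Ioo (endA β δ) (endB β δ) := by
  have hr := rad_pos hβ hδ
  have hrm := rad_le_mid hβ hδ
  have hA : 0 ≤ endA β δ := endA_nonneg
  have hB : 0 ≤ endB β δ := endB_nonneg
  have hA2 := endA_sq hβ hδ
  have hB2 := endB_sq hβ hδ
  ext t
  constructor
  · rintro ⟨θ, hθ, rfl⟩
    have h1 : Real.cos θ < 1 := by
      rw [← Real.cos_zero]
      exact Real.strictAntiOn_cos ⟨le_rfl, Real.pi_nonneg⟩ ⟨hθ.1.le, hθ.2.le⟩ hθ.1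
    have h2 : -1 < Real.cos θ := by
      rw [← Real.cos_pi]
      exact Real.strictAntiOn_cos ⟨hθ.1.le, hθ.2.le⟩ ⟨Real.pi_nonneg, le_rfl⟩ hθ.2
    exact ⟨Real.lt_sqrt_of_sq_lt (by rw [hA2]; nlinarith),
      (Real.sqrt_lt' (endA_nonneg.trans_lt (endA_lt_endB hβ hδ))).2 (by rw [hB2]; nlinarith)⟩
  · rintro ⟨h1, h2⟩
    have h3 : endA β δ ^ 2 < t ^ 2 := pow_lt_pow_left₀ h1 hA two_ne_zero
    have h4 : t ^ 2 < endB β δ ^ 2 := pow_lt_pow_left₀ h2 (hA.trans h1.le) two_ne_zero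
    have l1 : -1 < (t ^ 2 - mid β δ) / rad β δ := by rw [lt_div_iff₀ hr]; linarith
    have l2 : (t ^ 2 - mid β δ) / rad β δ < 1 := by rw [div_lt_iff₀ hr]; linarith
    refine ⟨Real.arccos ((t ^ 2 - mid β δ) / rad β δ), ⟨Real.arccos_pos.2 l2, ?_⟩, ?_⟩
    · refine lt_of_le_of_ne (Real.arccos_le_pi _) fun h => ?_
      rw [Real.arccos_eq_pi] at h
      linarith
    · simp only
      rw [Real.cos_arccos l1.le l2.le, mul_div_cancel₀ _ hr.ne', add_sub_cancel,
        Real.sqrt_sq (hA.trans h1.le)]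

/-- The substitution `t² = m + r cos θ`. -/
lemma integral_density_mul_comp_sq (hβ : 0 < β) (hδ : 0 ≤ δ) (g : ℝ → ℝ) :
    ∫ t, density β δ t * g (t ^ 2) = 2 / β * ((2 * Real.pi)⁻¹ * ∫ θ in (0 : ℝ)..2 * Real.pi,
      g (mid β δ + rad β δ * Real.cos θ) * angleWeight (mid β δ) (rad β δ) δ θ) := by
  have hr := rad_pos hβ hδ
  have hrm := rad_le_mid hβ hδ
  have hA : 0 ≤ endA β δ := endA_nonneg
  have hA2 := endA_sq hβ hδ
  have hB2 := endB_sq hβ hδ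
  have hms := mid_sq hβ hδ
  have hcos : ∀ θ ∈ Set.Ioo 0 Real.pi, -1 < Real.cos θ := fun θ hθ => by
    rw [← Real.cos_pi]
    exact Real.strictAntiOn_cos ⟨hθ.1.le, hθ.2.le⟩ ⟨Real.pi_nonneg, le_rfl⟩ hθ.2
  have hpos : ∀ θ ∈ Set.Ioo 0 Real.pi, 0 < mid β δ + rad β δ * Real.cos θ := fun θ hθ => by
    nlinarith [hcos θ hθ]
  have s1 : ∫ t, density β δ t * g (t ^ 2) = 2 * ∫ t in Set.Ioi 0, density β δ t * g (t ^ 2) := by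
    rw [← integral_comp_abs (f := fun t => density β δ t * g (t ^ 2))]
    simp only [density_abs hβ hδ, sq_abs]
  have s2 : ∫ t in Set.Ioi 0, density β δ t * g (t ^ 2)
      = ∫ t in Set.Ioo (endA β δ) (endB β δ), density β δ t * g (t ^ 2) := by
    refine setIntegral_eq_of_subset_of_forall_sdiff_eq_zero measurableSet_Ioi
      (fun t ht => hA.trans_lt ht.1) fun t ht => ?_
    have ht0 : 0 < t := ht.1
    rw [density_eq hβ hδ, Real.sqrt_eq_zero_of_nonpos, mul_zero, zero_mul]
    have h := ht.2
    rw [Set.mem_Ioo, not_and_or, not_lt, not_lt] at h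
    have hAB := endA_lt_endB hβ hδ
    rcases h with h | h
    · exact mul_nonpos_of_nonpos_of_nonneg (by nlinarith) (by nlinarith)
    · exact mul_nonpos_of_nonneg_of_nonpos (by nlinarith) (by nlinarith)
  have hder : ∀ θ ∈ Set.Ioo 0 Real.pi,
      HasDerivWithinAt (fun θ => √(mid β δ + rad β δ * Real.cos θ))
        (rad β δ * -Real.sin θ / (2 * √(mid β δ + rad β δ * Real.cos θ))) (Set.Ioo 0 Real.pi) θ :=
    fun θ hθ =>
      ((((Real.hasDerivAt_cos θ).const_mul _).const_add _).sqrt (hpos θ hθ).ne').hasDerivWithinAt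
  have hinj : Set.InjOn (fun θ => √(mid β δ + rad β δ * Real.cos θ)) (Set.Ioo 0 Real.pi) := by
    intro x hx y hy hxy
    have h1 := (Real.sqrt_inj (hpos x hx).le (hpos y hy).le).1 hxy
    refine Real.injOn_cos ⟨hx.1.le, hx.2.le⟩ ⟨hy.1.le, hy.2.le⟩ ?_
    exact mul_left_cancel₀ hr.ne' (add_left_cancel h1)
  rw [s1, s2, ← image_sqrt_cos hβ hδ, integral_image_eq_integral_abs_deriv_smul measurableSet_Ioo
    hder hinj]
  have s3 : ∀ θ ∈ Set.Ioo 0 Real.pi,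
      |rad β δ * -Real.sin θ / (2 * √(mid β δ + rad β δ * Real.cos θ))| •
        (density β δ √(mid β δ + rad β δ * Real.cos θ)
          * g (√(mid β δ + rad β δ * Real.cos θ) ^ 2))
      = (Real.pi * β)⁻¹ * (g (mid β δ + rad β δ * Real.cos θ)
          * angleWeight (mid β δ) (rad β δ) δ θ) := by
    intro θ hθ
    have hx := hpos θ hθ
    have hsin := Real.sin_pos_of_mem_Ioo hθ
    have hsq := Real.sq_sqrt hx.le
    have hsp := Real.sqrt_pos.2 hx
    have e0 : (mid β δ + rad β δ * Real.cos θ - (mid β δ - rad β δ))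
        * (mid β δ + rad β δ - (mid β δ + rad β δ * Real.cos θ)) = (rad β δ * Real.sin θ) ^ 2 := by
      rw [mul_pow, Real.sin_sq]; ring
    -- By m² = r² + δ²; the Jacobian supplies one factor r sin θ and the square root the other.
    have e1 : angleWeight (mid β δ) (rad β δ) δ θ
        = rad β δ ^ 2 * Real.sin θ ^ 2 / (mid β δ + rad β δ * Real.cos θ) := by
      rw [angleWeight, Real.sin_sq]
      field_simp
      linear_combination hms
    rw [density_eq hβ hδ, hsq, hA2, hB2, e0, Real.sqrt_sq (by positivity), abs_div, abs_mul,
      abs_neg, abs_of_pos hr, abs_of_pos hsin, abs_of_pos (by positivity :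
      0 < 2 * √(mid β δ + rad β δ * Real.cos θ)), abs_of_pos hsp, e1, smul_eq_mul]
    field_simp
    rw [hsq]
  rw [setIntegral_congr_fun measurableSet_Ioo s3, integral_const_mul]
  have s4 := integral_two_pi_comp_cos fun c => g (mid β δ + rad β δ * c)
    * (mid β δ - rad β δ * c - δ * (δ / (mid β δ + rad β δ * c)))
  unfold angleWeight
  rw [s4, intervalIntegral.integral_of_le Real.pi_nonneg, integral_Ioc_eq_integral_Ioo]
  field_simp

lemma isProbabilityMeasure_nu (hβ : 0 < β) (hδ : 0 ≤ δ) : IsProbabilityMeasure (nu β δ) := by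
  constructor
  rw [nu, withDensity_apply _ MeasurableSet.univ, Measure.restrict_univ,
    ← ofReal_integral_eq_lintegral_ofReal (integrable_density hβ hδ)
      (Eventually.of_forall (density_nonneg hβ))]
  have h1 := integral_density_mul_comp_sq hβ hδ fun _ => 1
  simp only [mul_one, one_mul] at h1
  -- Since m − δ = β/2, the total mass (2/β)(m − δ) is 1.
  rw [h1, circleAverage_angleWeight (mid_pos hβ hδ) (rad_pos hβ hδ) hδ (mid_sq hβ hδ), mid,
    add_sub_cancel_right, div_mul_div_comm, mul_comm 2 β, div_self (by positivity),
    ENNReal.ofReal_one]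

end Density

/-! ### Logarithmic integrals against the equilibrium density -/

section Potential

variable {β δ : ℝ}

/-- The singular part of `|log |x||`. -/
noncomputable def logSing (x : ℝ) : ℝ := (Set.Ioc (-1) 1).indicator (fun x => |Real.log x|) x

lemma logSing_nonneg (x : ℝ) : 0 ≤ logSing x := Set.indicator_nonneg (fun _ _ => abs_nonneg _) x

lemma integrable_logSing : Integrable logSing := by
  refine (integrable_indicator_iff measurableSet_Ioc).2 ?_
  have : IntervalIntegrable Real.log volume (-1) 1 := intervalIntegral.intervalIntegrable_log'
  exact ((intervalIntegrable_iff_integrableOn_Ioc_of_le (by norm_num)).1 this).abs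

lemma abs_log_abs_le (x : ℝ) : abs (Real.log |x|) ≤ logSing x + |x| := by
  by_cases h : x ∈ Set.Ioc (-1) 1
  · rw [logSing, Set.indicator_of_mem h, Real.log_abs]
    linarith [abs_nonneg x]
  · have h1 : 1 ≤ |x| := by
      rw [Set.mem_Ioc, not_and_or, not_lt, not_le] at h
      rcases h with h | h
      · exact le_abs.2 (Or.inr (by linarith))
      · exact le_abs.2 (Or.inl h.le)
    rw [logSing, Set.indicator_of_notMem h, zero_add, abs_of_nonneg (Real.log_nonneg h1)]
    exact log_abs_le x

/-- A bound for `∫ |log |t - s|| ν_{β,δ}(ds) - |t|` when the end point `b` is at most `B`. -/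
noncomputable def logBound (β B : ℝ) : ℝ := 2 / (Real.pi * β) * B * (∫ x, logSing x) + B

/-- The singular part of the logarithm is paid for by the sup bound of the density, the rest by its
compact support. After integration in s the bound depends only on β, B and |t|. -/
lemma abs_log_density_le (hβ : 0 < β) {B : ℝ} (hB : endB β δ ≤ B) (t s : ℝ) :
    density β δ s * abs (Real.log |t - s|) ≤ 2 / (Real.pi * β) * B * logSing (t - s)
      + density β δ s * (|t| + B) := by
  have h0 := density_nonneg (δ := δ) hβ s
  have h1 : density β δ s ≤ 2 / (Real.pi * β) * B :=
    (density_le hβ s).trans (mul_le_mul_of_nonneg_left hB (by positivity))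
  by_cases hs : endB β δ < |s|
  · rw [density_eq_zero hs, zero_mul, zero_mul, add_zero]
    exact mul_nonneg (mul_nonneg (by positivity) (endB_nonneg.trans hB)) (logSing_nonneg _)
  · have h2 : |t - s| ≤ |t| + B := (abs_sub _ _).trans (by linarith)
    calc density β δ s * abs (Real.log |t - s|)
        ≤ density β δ s * (logSing (t - s) + (|t| + B)) :=
          mul_le_mul_of_nonneg_left ((abs_log_abs_le _).trans (by linarith)) h0
      _ ≤ _ := by
          rw [mul_add]
          exact add_le_add (mul_le_mul_of_nonneg_right h1 (logSing_nonneg _)) le_rfl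

lemma integrable_log_sub_nu (hβ : 0 < β) (hδ : 0 ≤ δ) (t : ℝ) :
    Integrable (fun s => Real.log |t - s|) (nu β δ) := by
  rw [integrable_nu_iff hβ hδ]
  refine Integrable.mono' ((((integrable_logSing.comp_sub_left t).const_mul
    (2 / (Real.pi * β) * endB β δ))).add ((integrable_density hβ hδ).mul_const (|t| + endB β δ)))
    (((measurable_density hβ hδ).mul (Real.measurable_log.comp
      (by fun_prop))).aestronglyMeasurable) (Eventually.of_forall fun s => ?_)
  rw [Real.norm_eq_abs, abs_mul, abs_of_nonneg (density_nonneg hβ s)]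
  exact abs_log_density_le hβ le_rfl t s

lemma integral_density (hβ : 0 < β) (hδ : 0 ≤ δ) : ∫ t, density β δ t = 1 := by
  have := isProbabilityMeasure_nu hβ hδ
  have h := integral_nu hβ hδ fun _ => 1
  simpa using h.symm

lemma integral_abs_log_nu_le (hβ : 0 < β) (hδ : 0 ≤ δ) {B : ℝ} (hB : endB β δ ≤ B) (t : ℝ) :
    ∫ s, abs (Real.log |t - s|) ∂(nu β δ) ≤ logBound β B + |t| := by
  have hi := (integrable_nu_iff hβ hδ _).1 (integrable_log_sub_nu hβ hδ t).abs
  rw [integral_nu hβ hδ]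
  have i1 := (integrable_logSing.comp_sub_left t).const_mul (2 / (Real.pi * β) * B)
  have i2 := (integrable_density hβ hδ).mul_const (|t| + B)
  refine (integral_mono hi (i1.add i2) fun s => abs_log_density_le hβ hB t s).trans_eq ?_
  simp only [Pi.add_apply]
  rw [integral_add i1 i2, integral_const_mul, integral_mul_const, integral_density hβ hδ,
    integral_sub_left_eq_self (fun x => logSing x), logBound]
  ring

lemma integrable_log_sub_prod_nu (hβ : 0 < β) (hδ : 0 ≤ δ) {ν : Measure ℝ} [IsFiniteMeasure ν]
    (hν : Integrable (fun t => t) ν) :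
    Integrable (fun p : ℝ × ℝ => Real.log |p.1 - p.2|) (ν.prod (nu β δ)) := by
  have := isProbabilityMeasure_nu hβ hδ
  have hm : AEStronglyMeasurable (fun p : ℝ × ℝ => Real.log |p.1 - p.2|) (ν.prod (nu β δ)) :=
    Measurable.aestronglyMeasurable (by fun_prop)
  rw [integrable_prod_iff hm]
  refine ⟨Eventually.of_forall fun t => integrable_log_sub_nu hβ hδ t, ?_⟩
  refine Integrable.mono' ((integrable_const (logBound β (endB β δ))).add hν.abs)
    hm.norm.integral_prod_right' (Eventually.of_forall fun t => ?_)
  rw [Real.norm_eq_abs, abs_of_nonneg (integral_nonneg fun _ => norm_nonneg _)]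
  exact integral_abs_log_nu_le hβ hδ le_rfl t

lemma ae_ne_nu (t : ℝ) : ∀ᵐ s ∂(nu β δ), s ≠ t := by
  refine (withDensity_absolutelyContinuous _ _).ae_le ?_
  filter_upwards [(Set.countable_singleton t).ae_notMem volume] with s hs using hs

lemma ae_ne_prod_nu (hβ : 0 < β) (hδ : 0 ≤ δ) (ν : Measure ℝ) [IsFiniteMeasure ν] :
    ∀ᵐ p : ℝ × ℝ ∂(ν.prod (nu β δ)), p.1 ≠ p.2 := by
  have := isProbabilityMeasure_nu hβ hδ
  refine (Measure.ae_prod_iff_ae_ae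
    (measurableSet_eq_fun measurable_fst measurable_snd).compl).2 ?_
  refine Eventually.of_forall fun t => ?_
  filter_upwards [ae_ne_nu t] with s hs using hs.symm

lemma integrable_sq_nu (hβ : 0 < β) (hδ : 0 ≤ δ) : Integrable (fun t => t ^ 2) (nu β δ) := by
  rw [integrable_nu_iff hβ hδ]
  refine Integrable.mono' ((integrable_density hβ hδ).mul_const (endB β δ ^ 2))
    ((measurable_density hβ hδ).mul (by fun_prop)).aestronglyMeasurable
    (Eventually.of_forall fun t => ?_)
  rw [Real.norm_eq_abs, abs_mul, abs_of_nonneg (density_nonneg hβ t), abs_sq]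
  by_cases ht : endB β δ < |t|
  · rw [density_eq_zero ht, zero_mul, zero_mul]
  · refine mul_le_mul_of_nonneg_left ?_ (density_nonneg hβ t)
    rw [← sq_abs t]
    exact pow_le_pow_left₀ (abs_nonneg t) (not_lt.1 ht) 2

/-- The parameter γ is independent of δ, so that the measure can be tested in the energy at another
parameter. -/
lemma hasFiniteEnergy_nu (hβ : 0 < β) (hδ : 0 ≤ δ) (γ : ℝ) : HasFiniteEnergy γ (nu β δ) := by
  have := isProbabilityMeasure_nu hβ hδ
  have hid : Integrable (fun t => t) (nu β δ) := by
    refine Integrable.mono' ((integrable_sq_nu hβ hδ).add (integrable_const 1))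
      measurable_id.aestronglyMeasurable (Eventually.of_forall fun t => ?_)
    simp only [Real.norm_eq_abs, Pi.add_apply]
    nlinarith [sq_nonneg (|t| - 1), sq_abs t]
  exact ⟨integrable_sq_nu hβ hδ,
    by simpa using (integrable_log_sub_nu hβ hδ 0).const_mul γ, fun _ => ae_ne_nu 0,
    integrable_log_sub_prod_nu hβ hδ hid, ae_ne_prod_nu hβ hδ _⟩

/-- The logarithmic potential of `ν_{β,δ}`. -/
lemma integral_log_sub_nu (hβ : 0 < β) (hδ : 0 ≤ δ) (t : ℝ) :
    ∫ s, Real.log |t - s| ∂(nu β δ) = squarePotential (mid β δ) (rad β δ) δ (t ^ 2) / β := by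
  -- By evenness the potential is half the integral of log|t − s| + log|t + s| = log|t² − s²|, which
  -- depends on s² only.
  have h1 : ∫ s, Real.log |t + s| ∂(nu β δ) = ∫ s, Real.log |t - s| ∂(nu β δ) := by
    rw [integral_nu hβ hδ, integral_nu hβ hδ,
      ← integral_neg_eq_self (fun s => density β δ s * Real.log |t - s|)]
    simp only [density_neg hβ hδ, sub_neg_eq_add]
  have i2 : Integrable (fun s => Real.log |t + s|) (nu β δ) := by
    have := (integrable_nu_iff hβ hδ _).1 (integrable_log_sub_nu hβ hδ t)
    rw [integrable_nu_iff hβ hδ]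
    simpa only [density_neg hβ hδ, sub_neg_eq_add] using this.comp_neg
  have h2 : ∫ s, Real.log |t ^ 2 - s ^ 2| ∂(nu β δ)
      = ∫ s, Real.log |t - s| ∂(nu β δ) + ∫ s, Real.log |t + s| ∂(nu β δ) := by
    rw [← integral_add (integrable_log_sub_nu hβ hδ t) i2]
    refine integral_congr_ae ?_
    filter_upwards [ae_ne_nu t, ae_ne_nu (-t)] with s h3 h4
    rw [← Real.log_mul (abs_ne_zero.2 (sub_ne_zero.2 h3.symm))
      (abs_ne_zero.2 fun h => h4 (by linarith)), ← abs_mul]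
    ring_nf
  rw [integral_nu hβ hδ, integral_density_mul_comp_sq hβ hδ fun x => Real.log |t ^ 2 - x|,
    h1] at h2
  rw [squarePotential]
  field_simp at h2 ⊢
  linarith

end Potential

/-! ### Minimality and continuity in the parameter -/

section Equilibrium

variable {β δ : ℝ}

/-- The Euler–Lagrange function at T = t² is Q_δ(t) minus β times the potential; by Fubini its
ν-integral is the external energy minus β times a mutual logarithmic integral. -/
lemma sub_squarePotential_sq (hβ : 0 < β) (hδ : 0 ≤ δ) {ν : Measure ℝ} [IsProbabilityMeasure ν]
    (h : HasFiniteEnergy δ ν) :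
    Integrable (fun t => t ^ 2 - δ * Real.log (t ^ 2)
      - squarePotential (mid β δ) (rad β δ) δ (t ^ 2)) ν ∧
    ∫ t, (t ^ 2 - δ * Real.log (t ^ 2) - squarePotential (mid β δ) (rad β δ) δ (t ^ 2)) ∂ν
      = (∫ t, t ^ 2 ∂ν - 2 * ∫ t, δ * Real.log |t| ∂ν)
        - β * ∫ p, Real.log |p.1 - p.2| ∂(ν.prod (nu β δ)) := by
  have := isProbabilityMeasure_nu hβ hδ
  have hl := integrable_log_sub_prod_nu hβ hδ h.integrable_id
  have hi := hl.integral_prod_left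
  rw [integral_prod _ hl]
  have e : ∀ t : ℝ, t ^ 2 - δ * Real.log (t ^ 2) - squarePotential (mid β δ) (rad β δ) δ (t ^ 2)
      = t ^ 2 - 2 * (δ * Real.log |t|) - β * ∫ s, Real.log |t - s| ∂(nu β δ) := fun t => by
    rw [integral_log_sub_nu hβ hδ, ← sq_abs t, Real.log_pow]
    field_simp
    push_cast
    ring
  simp only [e]
  have i1 : Integrable (fun t => t ^ 2 - 2 * (δ * Real.log |t|)) ν :=
    h.integrable_sq.sub (h.integrable_log.const_mul 2)
  refine ⟨i1.sub (hi.const_mul β), ?_⟩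
  rw [integral_sub i1 (hi.const_mul β), integral_sub h.integrable_sq (h.integrable_log.const_mul 2),
    integral_const_mul 2, integral_const_mul β]

lemma ae_mem_supportSet : ∀ᵐ t ∂(nu β δ), t ∈ supportSet β δ := by
  have hS : MeasurableSet (supportSet β δ) := measurableSet_Icc.union measurableSet_Icc
  rw [ae_iff, nu]
  change (volume.withDensity _) (supportSet β δ)ᶜ = 0
  rw [withDensity_apply _ hS.compl]
  refine (setLIntegral_congr_fun (g := 0) hS.compl fun t ht => ?_).trans (by simp)
  simp [density, Set.indicator_of_notMem (show t ∉ supportSet β δ from ht)]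

/-- Positive definiteness bounds the self-interaction of ν through its interaction with ν₀ = `nu β
δ`. The remaining Euler–Lagrange integral is at least the constant, which ν₀ attains. -/
theorem realEnergy_nu_le (hβ : 0 < β) (hδ : 0 ≤ δ) {ν : Measure ℝ} [IsProbabilityMeasure ν]
    (h : HasFiniteEnergy δ ν) : realEnergy β δ (nu β δ) ≤ realEnergy β δ ν := by
  have := isProbabilityMeasure_nu hβ hδ
  have hm := mid_pos hβ hδ
  have hr := rad_pos hβ hδ
  have hmr := mid_sq hβ hδ
  have h0 := hasFiniteEnergy_nu hβ hδ δ
  have hpd := two_mul_integral_log_le h.integrable_id h0.integrable_id h.integrable_log_sub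
    h0.integrable_log_sub (integrable_log_sub_prod_nu hβ hδ h.integrable_id) h.ae_ne h0.ae_ne
    (ae_ne_prod_nu hβ hδ ν)
  obtain ⟨i1, e1⟩ := sub_squarePotential_sq hβ hδ h
  obtain ⟨i0, e0⟩ := sub_squarePotential_sq hβ hδ h0
  have l1 : lagrangeConst (mid β δ) (rad β δ) δ ≤ ∫ t, (t ^ 2 - δ * Real.log (t ^ 2)
      - squarePotential (mid β δ) (rad β δ) δ (t ^ 2)) ∂ν := by
    have hc : ∫ _, lagrangeConst (mid β δ) (rad β δ) δ ∂ν
        = lagrangeConst (mid β δ) (rad β δ) δ := by simp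
    rw [← hc]
    refine integral_mono_ae (integrable_const _) i1 ?_
    have hne : ∀ᵐ t ∂ν, 0 < δ → t ≠ 0 := by
      by_cases hδ0 : 0 < δ
      · filter_upwards [h.ae_ne_zero hδ0] with t ht _ using ht
      · exact Eventually.of_forall fun t h1 => absurd h1 hδ0
    filter_upwards [hne] with t ht
    exact lagrangeConst_le hm hr hδ hmr (sq_nonneg t) fun hδ0 => pow_ne_zero 2 (ht hδ0)
  have l0 : ∫ t, (t ^ 2 - δ * Real.log (t ^ 2)
      - squarePotential (mid β δ) (rad β δ) δ (t ^ 2)) ∂(nu β δ)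
      = lagrangeConst (mid β δ) (rad β δ) δ := by
    have hc : ∫ _, lagrangeConst (mid β δ) (rad β δ) δ ∂(nu β δ)
        = lagrangeConst (mid β δ) (rad β δ) δ := by simp
    conv_rhs => rw [← hc]
    refine integral_congr_ae ?_
    filter_upwards [ae_mem_supportSet] with t ht
    rw [mem_supportSet_iff] at ht
    refine sub_squarePotential_eq_of_mem hm hr hδ hmr ⟨?_, ?_⟩
    · rw [← endA_sq hβ hδ, ← sq_abs t]
      exact pow_le_pow_left₀ endA_nonneg ht.1 2
    · rw [← endB_sq hβ hδ, ← sq_abs t]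
      exact pow_le_pow_left₀ (abs_nonneg t) ht.2 2
  rw [realEnergy, realEnergy]
  have hpd' := mul_le_mul_of_nonneg_left hpd (by positivity : 0 ≤ β / 2)
  linarith

theorem equilibriumEnergy_eq (hβ : 0 < β) (hδ : 0 ≤ δ) :
    equilibriumEnergy β δ = ((realEnergy β δ (nu β δ) : ℝ) : EReal) := by
  have := isProbabilityMeasure_nu hβ hδ
  refine le_antisymm ?_ (le_iInf fun ν => ?_)
  · rw [← energy_eq_coe hδ (hasFiniteEnergy_nu hβ hδ δ)]
    exact iInf_le (fun ν : ProbabilityMeasure ℝ => energy β δ (ν : Measure ℝ))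
      ⟨nu β δ, isProbabilityMeasure_nu hβ hδ⟩
  · by_cases h : energy β δ (ν : Measure ℝ) = ⊤
    · rw [h]; exact le_top
    · have hf := hasFiniteEnergy_of_energy_ne_top hβ hδ h
      rw [energy_eq_coe hδ hf]
      exact EReal.coe_le_coe_iff.2 (realEnergy_nu_le hβ hδ hf)

theorem isEquilibriumMeasure_nu (hβ : 0 < β) (hδ : 0 ≤ δ) :
    IsEquilibriumMeasure β δ (nu β δ) := by
  have e := energy_eq_coe (β := β) hδ (hasFiniteEnergy_nu hβ hδ δ)
  exact ⟨isProbabilityMeasure_nu hβ hδ, by rw [e]; exact EReal.coe_ne_bot _,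
    by rw [e]; exact EReal.coe_ne_top _, by rw [e, equilibriumEnergy_eq hβ hδ]⟩

lemma continuous_endB : Continuous (endB β) := by
  unfold endB
  fun_prop

lemma continuous_endA : Continuous (endA β) := by
  unfold endA
  fun_prop

/-- Weak continuity of `δ ↦ ν_{β,δ}`. -/
theorem tendsto_integral_nu (hβ : 0 < β) {α : ℕ → ℝ} (hα : ∀ n, 0 ≤ α n) {c : ℝ}
    (hc : Tendsto α atTop (𝓝 c)) (f : ℝ →ᵇ ℝ) :
    Tendsto (fun n => ∫ t, f t ∂(nu β (α n))) atTop (𝓝 (∫ t, f t ∂(nu β c))) := by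
  have hc0 : 0 ≤ c := ge_of_tendsto' hc hα
  simp only [integral_nu hβ (hα _), integral_nu hβ hc0]
  have hA := ((continuous_endA (β := β)).tendsto c).comp hc
  have hB := ((continuous_endB (β := β)).tendsto c).comp hc
  refine tendsto_integral_filter_of_dominated_convergence
    (fun t => (Set.Icc (-(endB β c + 1)) (endB β c + 1)).indicator
      (fun _ => 2 / (Real.pi * β) * (endB β c + 1)) t * ‖f‖) ?_ ?_ ?_ ?_
  · exact Eventually.of_forall fun n => ((measurable_density hβ (hα n)).mul
      f.continuous.measurable).aestronglyMeasurable
  · filter_upwards [hB.eventually_le_const (lt_add_one _)] with n hn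
    refine Eventually.of_forall fun t => ?_
    rw [norm_mul, Real.norm_eq_abs, abs_of_nonneg (density_nonneg hβ t)]
    have h1 := density_le_indicator hβ hn t
    exact mul_le_mul h1 (f.norm_coe_le_norm t) (norm_nonneg _) ((density_nonneg hβ t).trans h1)
  · exact (integrable_indicator_Icc_const _ _).mul_const _
  · refine Eventually.of_forall fun t => Tendsto.mul_const _ ?_
    simp only [density_eq hβ (hα _), density_eq hβ hc0]
    refine Tendsto.const_mul _ (Tendsto.sqrt ?_)
    exact ((hA.pow 2).const_sub _).mul ((hB.pow 2).sub_const _)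

lemma realEnergy_eq_add (β δ γ : ℝ) (ν : Measure ℝ) :
    realEnergy β δ ν = realEnergy β γ ν - 2 * (δ - γ) * ∫ t, Real.log |t| ∂ν := by
  rw [realEnergy, realEnergy, integral_const_mul, integral_const_mul]
  ring

/-- Minimality at each parameter, tested with the minimiser of the other, bounds the difference of
the energies on both sides by 2|α n − c| K. -/
theorem tendsto_equilibriumEnergy (hβ : 0 < β) {α : ℕ → ℝ} (hα : ∀ n, 0 ≤ α n) {c : ℝ}
    (hc : Tendsto α atTop (𝓝 c)) :
    Tendsto (fun n => equilibriumEnergy β (α n)) atTop (𝓝 (equilibriumEnergy β c)) := by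
  have hc0 : 0 ≤ c := ge_of_tendsto' hc hα
  simp only [equilibriumEnergy_eq hβ (hα _), equilibriumEnergy_eq hβ hc0]
  refine (continuous_coe_real_ereal.tendsto _).comp ?_
  -- Eventually b at α n is at most its limit plus 1, so one K bounds the logarithmic moments of
  -- both measures.
  set K := logBound β (endB β c + 1) with hK
  have hB := ((continuous_endB (β := β)).tendsto c).comp hc
  have hlog : ∀ δ, 0 ≤ δ → endB β δ ≤ endB β c + 1 → |∫ t, Real.log |t| ∂(nu β δ)| ≤ K := by
    intro δ hδ h
    have h1 := integral_abs_log_nu_le hβ hδ h 0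
    simp only [zero_sub, abs_neg, abs_zero, add_zero] at h1
    exact abs_integral_le_integral_abs.trans h1
  have hbound : ∀ᶠ n in atTop, |realEnergy β (α n) (nu β (α n)) - realEnergy β c (nu β c)|
      ≤ 2 * |α n - c| * K := by
    filter_upwards [hB.eventually_le_const (lt_add_one _)] with n hn
    have := isProbabilityMeasure_nu hβ hc0
    have := isProbabilityMeasure_nu hβ (hα n)
    have u1 := realEnergy_nu_le hβ (hα n) (hasFiniteEnergy_nu hβ hc0 (α n))
    have u2 := realEnergy_nu_le hβ hc0 (hasFiniteEnergy_nu hβ (hα n) c)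
    rw [realEnergy_eq_add β (α n) c (nu β c)] at u1
    rw [realEnergy_eq_add β c (α n) (nu β (α n))] at u2
    have k1 : |2 * (α n - c) * ∫ t, Real.log |t| ∂(nu β c)| ≤ 2 * |α n - c| * K := by
      rw [abs_mul, abs_mul, abs_two]
      exact mul_le_mul_of_nonneg_left (hlog c hc0 (lt_add_one _).le) (by positivity)
    have k2 : |2 * (c - α n) * ∫ t, Real.log |t| ∂(nu β (α n))| ≤ 2 * |α n - c| * K := by
      rw [abs_mul, abs_mul, abs_two, abs_sub_comm]
      exact mul_le_mul_of_nonneg_left (hlog _ (hα n) hn) (by positivity)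
    rw [abs_le] at k1 k2 ⊢
    constructor <;> linarith [k1.1, k1.2, k2.1, k2.2]
  rw [tendsto_iff_dist_tendsto_zero]
  have h0 : Tendsto (fun n => 2 * |α n - c| * K) atTop (𝓝 0) := by
    have := (((hc.sub_const c).abs).const_mul 2).mul_const K
    simpa using this
  exact squeeze_zero' (Eventually.of_forall fun n => dist_nonneg) hbound h0

end Equilibrium

end ChiralEnsemble

theorem lemma4p5 (β : ℝ) (hβ : 0 < β) (μ : ℕ → ℝ) (hμ : ∀ n, 0 ≤ μ n) (c : ℝ)
    (hc : Tendsto (fun n : ℕ => μ n / (n : ℝ)) atTop (𝓝 c)) :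
    -- the measures in question are the equilibrium measures, with finite energies
    (∀ n : ℕ, 1 ≤ n → ChiralEnsemble.IsEquilibriumMeasure β (μ n / (n : ℝ))
        (ChiralEnsemble.nu β (μ n / (n : ℝ)))) ∧
    ChiralEnsemble.IsEquilibriumMeasure β c (ChiralEnsemble.nu β c) ∧
    -- weak convergence
    (∀ f : ℝ →ᵇ ℝ,
      Tendsto (fun n : ℕ => ∫ t, f t ∂(ChiralEnsemble.nu β (μ n / (n : ℝ)))) atTop
        (𝓝 (∫ t, f t ∂(ChiralEnsemble.nu β c)))) ∧
    -- convergence of the equilibrium energies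
    Tendsto (fun n : ℕ => ChiralEnsemble.equilibriumEnergy β (μ n / (n : ℝ))) atTop
      (𝓝 (ChiralEnsemble.equilibriumEnergy β c)) := by
  -- At n = 0 the quotient is 0 by convention, so nonnegativity holds for every n.
  have hα : ∀ n : ℕ, 0 ≤ μ n / (n : ℝ) := fun n => div_nonneg (hμ n) n.cast_nonneg
  exact ⟨fun n _ => ChiralEnsemble.isEquilibriumMeasure_nu hβ (hα n),
    ChiralEnsemble.isEquilibriumMeasure_nu hβ (ge_of_tendsto' hc hα),
    ChiralEnsemble.tendsto_integral_nu hβ hα hc, ChiralEnsemble.tendsto_equilibriumEnergy hβ hα hc⟩
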